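/- **Setting.** For every $n\in\mathbb N$ let $d=d_n\ge 1$ (the dimension and all objects below may depend on $n$; in particular $d$, $\Theta$, $\pi$, $\theta_*$ may be fixed). The data $y_{1:n}$ have true law $P_0^n$. The model $\{P^n_\theta:\theta\in\Theta\}$, $\Theta\subseteq\mathbb R^{d}$ measurable, is dominated, with likelihood $L(\theta)=L(\theta;y_{1:n})\ge 0$ and $\ell=\log L$ (with $\log 0=-\infty$), and $\pi$ is a prior probability density on $\Theta$; outside $\Theta$ the product $\pi L$ is set to $0$. Let $\pi_n(\theta)=\pi(\theta)L(\theta)/\int\pi L$ be the posterior density, let $\tilde\theta$ be a (measurable) maximizer of $\pi L$ over $\Theta$, let $J=-(\ell^{(2)}(\tilde\theta)+(\log\pi)^{(2)}(\tilde\theta))$, and $$w^*(\theta)=\frac{\pi(\theta)L(\theta)}{\pi(\theta)L(\theta)+\pi(2\tilde\theta-\theta)L(2\tilde\theta-\theta)}\qquad(=1/2\text{ if }0/0).$$ Put $f^*_1(\theta)=\phi_d(\theta;\tilde\theta,J^{-1})$ (Gaussian density with mean $\tilde\theta$ and covariance $J^{-1}$) and $f^*_2(\theta)=\phi_d(\theta;\tilde\theta,J^{-1})P(\theta-\tilde\theta)\big/\int\phi_d(t;\tilde\theta,J^{-1})P(t-\tilde\theta)\,dt$,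 where $$P(v)=1+\tfrac1{24}\langle\ell^{(4)}(\tilde\theta),v^{\otimes4}\rangle+\tfrac12\Big[\tfrac1{24}\langle\ell^{(4)}(\tilde\theta),v^{\otimes4}\rangle\Big]^2+\tfrac12\Big[\tfrac16\langle\ell^{(3)}(\tilde\theta),v^{\otimes3}\rangle\Big]^2 ,$$ and let $q^*_k(\theta)=2f^*_k(\theta)w^*(\theta)$, $k=1,2$. Write $D_{TV}(p,q)=\frac12\int|p-q|$. **Assumptions** (all constants, including the radius of the neighbourhood in 2, are independent of $n$ and $d$). 1. For every $n$, $P^n_{\theta_*}$, $\theta_*\in\Theta$, is the unique Kullback–Leibler projection of $P_0^n$ onto $\{P_\theta^n:\theta\in\Theta\}$; $P_0^n$ need not belong to the model. 2. $\log\pi$ is (finite and) four times continuously differentiable on a neighbourhood of $\theta_*$ contained in $\Theta$, and $0<\pi(\theta_*)<\infty$; if the dimension or the prior varies with $n$, positivity is meant in the sense that $\pi(\theta_*)\ge n^{-Cd}$ for some constant $C$ and all large $n$ (automatic when $d$, $\pi$ and $\theta_*$ are fixed). 3. For every $M_n\to\infty$ there is $c_1>0$ such that $P_0^n\big\{\sup_{\theta\in\Theta,\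 \|\theta-\theta_*\|>M_n\sqrt d/\sqrt n}(\ell(\theta)-\ell(\theta_*))/n<-c_1M_n^2d/n\big\}\to1$. 4. $\mathbb E_{P_0^n}\|\tilde\theta-\theta_*\|^2=O(d/n)$. 5. There are $\bar\eta_1,\bar\eta_2>0$ such that, with $P_0^n$-probability tending to one, all eigenvalues of $J/n$ lie in $(\bar\eta_1,\bar\eta_2)$. There are $\delta,L_0>0$ such that, with $P_0^n$-probability tending to one, at all interior points $\theta$ of $\Theta$ with $\|\theta-\tilde\theta\|<\delta$ the function $\ell$ is (finite and) $C^4$, $\log\pi$ is (finite and) $C^2$, and $\|\ell^{(3)}(\theta)/n\|,\ \|\ell^{(4)}(\theta)/n\|,\ \|(\log\pi)^{(2)}(\theta)\|<L_0$ in spectral norm. 6. (Only for $f_2^*$.) With the same $\delta,L_0$ and in the same sense, $\ell$ is moreover $C^6$, $\log\pi$ is $C^4$, and $\|\ell^{(5)}(\theta)/n\|,\ \|\ell^{(6)}(\theta)/n\|,\ \|(\log\pi)^{(3)}(\theta)\|,\ \|(\log\pi)^{(4)}(\theta)\|<L_0$. **Theorem.** There are fixed constants $c_0,c_3,c_4>0$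 such that, with $M_n=\sqrt{c_0\log n}$: under Assumptions 1–5, $$D_{TV}(\pi_n,q^*_1)=O_{P_0^n}\big(M_n^{c_3}d^3/n\big),$$ and under Assumptions 1–6, $$D_{TV}(\pi_n,q^*_2)=O_{P_0^n}\big(M_n^{c_4}d^6/n^2\big).$$ -/

import Mathlib

open MeasureTheory Filter Topology Set

noncomputable section

/-- The parameter space `ℝᵈ` with its Euclidean norm. -/
abbrev Par (d : ℕ) : Type := EuclideanSpace ℝ (Fin d)

/-- A dominated statistical model `{P_θ : θ ∈ Θ}`, `Θ ⊆ ℝᵈ`, for an observation in `Y` (the whole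
sample `y_{1:n}`), together with a proper prior density on `Θ`.  The values of `lik` and `prior`
at parameters outside `Θ` are irrelevant. -/
structure BayesModel (d : ℕ) (Y : Type*) [MeasurableSpace Y] where
  /-- parameter space -/
  Θ : Set (Par d)
  measurableSet_Θ : MeasurableSet Θ
  /-- dominating measure -/
  μ : Measure Y
  sigmaFinite_μ : SigmaFinite μ
  /-- likelihood `L(θ; y)`: the density of `P_θ` at `y` -/
  lik : Par d → Y → ℝ
  lik_nonneg : ∀ θ y, 0 ≤ lik θ y
  measurable_lik : Measurable (fun x : Par d × Y => lik x.1 x.2)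
  lintegral_lik : ∀ θ ∈ Θ, ∫⁻ y, ENNReal.ofReal (lik θ y) ∂μ = 1
  /-- prior density -/
  prior : Par d → ℝ
  prior_nonneg : ∀ θ, 0 ≤ prior θ
  measurable_prior : Measurable prior
  lintegral_prior : ∫⁻ θ in Θ, ENNReal.ofReal (prior θ) = 1

namespace BayesModel

variable {d : ℕ} {Y : Type*} [MeasurableSpace Y] (B : BayesModel d Y)

/-- The law `P_θ`. -/
def law (θ : Par d) : Measure Y :=
  B.μ.withDensity (fun y => ENNReal.ofReal (B.lik θ y))

/-- The log-likelihood, with value `-∞` where the likelihood vanishes. -/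
def elogLik (y : Y) (θ : Par d) : EReal := ENNReal.log (ENNReal.ofReal (B.lik θ y))

/-- The real-valued log-likelihood, meaningful where the likelihood is positive. -/
def logLik (y : Y) (θ : Par d) : ℝ := Real.log (B.lik θ y)

/-- The log-prior density, meaningful where the prior density is positive. -/
def logPrior (θ : Par d) : ℝ := Real.log (B.prior θ)

/-- The unnormalised posterior density `π(θ) L(θ; y)`, equal to `0` outside `Θ`. -/
def unnormPost (y : Y) : Par d → ℝ := B.Θ.indicator (fun θ => B.prior θ * B.lik θ y)

/-- The posterior density `π_n(θ) = π(θ) L(θ; y) / c(y)`. -/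
def post (y : Y) (θ : Par d) : ℝ := B.unnormPost y θ / ∫ t, B.unnormPost y t

/-- `m` is a maximum a posteriori value for the observation `y`. -/
def IsMAP (y : Y) (m : Par d) : Prop :=
  m ∈ B.Θ ∧ ∀ θ ∈ B.Θ, B.prior θ * B.lik θ y ≤ B.prior m * B.lik m y

/-- The skewness-inducing factor `w*_m(θ)`, with its convention `1/2` for `0/0`. -/
def skewFactor (y : Y) (m θ : Par d) : ℝ :=
  open Classical in
  if B.unnormPost y θ = 0 ∧ B.unnormPost y ((2 : ℝ) • m - θ) = 0 then 1 / 2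
  else B.unnormPost y θ / (B.unnormPost y θ + B.unnormPost y ((2 : ℝ) • m - θ))

/-- The matrix `J_m = -(ℓ⁽²⁾(m) + (log π)⁽²⁾(m))`. -/
def negHess (y : Y) (m : Par d) : Matrix (Fin d) (Fin d) ℝ := fun i j =>
  -(iteratedFDeriv ℝ 2 (B.logLik y) m ![EuclideanSpace.single i 1, EuclideanSpace.single j 1]
    + iteratedFDeriv ℝ 2 B.logPrior m ![EuclideanSpace.single i 1, EuclideanSpace.single j 1])

/-- `⟨ℓ⁽ᵏ⁾(m), v^{⊗k}⟩`. -/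
def likTensor (y : Y) (m : Par d) (k : ℕ) (v : Par d) : ℝ :=
  iteratedFDeriv ℝ k (B.logLik y) m (fun _ => v)

/-- The polynomial `P(v)` of the fourth-order extension, at `v = θ - m`. -/
def snpPoly (y : Y) (m v : Par d) : ℝ :=
  1 + 1 / 24 * B.likTensor y m 4 v + 1 / 2 * (1 / 24 * B.likTensor y m 4 v) ^ 2
    + 1 / 2 * (1 / 6 * B.likTensor y m 3 v) ^ 2

end BayesModel

/-- The density `φ_d(θ; m, S)` of the Gaussian law on `ℝᵈ` with mean `m` and covariance `S`. -/
def gaussDensity {d : ℕ} (m : Par d) (S : Matrix (Fin d) (Fin d) ℝ) (θ : Par d) : ℝ :=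
  (Real.sqrt ((2 * Real.pi) ^ d * S.det))⁻¹
    * Real.exp (-(1 / 2) * ((fun i => (θ - m) i) ⬝ᵥ (S⁻¹.mulVec (fun i => (θ - m) i))))

namespace BayesModel

variable {d : ℕ} {Y : Type*} [MeasurableSpace Y] (B : BayesModel d Y)

/-- The Laplace approximation `f*_{m,1} = φ_d(·; m, J_m⁻¹)`. -/
def laplace (y : Y) (m θ : Par d) : ℝ := gaussDensity m (B.negHess y m)⁻¹ θ

/-- The fourth-order semi-nonparametric symmetric approximation `f*_{m,2}`. -/
def snp (y : Y) (m θ : Par d) : ℝ :=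
  B.laplace y m θ * B.snpPoly y m (θ - m) / ∫ t, B.laplace y m t * B.snpPoly y m (t - m)

/-- The skew-symmetric perturbation `2 f(θ) w*_m(θ)` of a density `f` symmetric about `m`. -/
def skewPerturb (y : Y) (m : Par d) (f : Par d → ℝ) (θ : Par d) : ℝ :=
  2 * f θ * B.skewFactor y m θ

end BayesModel

/-- Total variation distance `(1/2) ∫ |p - q|` of two densities on `ℝᵈ`. -/
def tvDist {d : ℕ} (p q : Par d → ℝ) : ENNReal := (∫⁻ θ, ENNReal.ofReal |p θ - q θ|) / 2

/-- `P n (E n) → 1`, stated through the complements so that no measurability is needed. -/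
def WithProbToOne {Y : ℕ → Type*} [∀ n, MeasurableSpace (Y n)]
    (P : ∀ n, Measure (Y n)) (E : ∀ n, Set (Y n)) : Prop :=
  Tendsto (fun n => P n (E n)ᶜ) atTop (𝓝 0)

/-- `X n = O_{P n}(r n)`. -/
def IsBigOProb {Y : ℕ → Type*} [∀ n, MeasurableSpace (Y n)]
    (P : ∀ n, Measure (Y n)) (X : ∀ n, Y n → ENNReal) (r : ℕ → ℝ) : Prop :=
  ∀ ε : ℝ, 0 < ε → ∃ K : ℝ, 0 < K ∧ ∀ᶠ n in atTop,
    P n {y | ENNReal.ofReal (K * r n) < X n y} ≤ ENNReal.ofReal ε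

section Assumptions

variable {d : ℕ → ℕ} {Y : ℕ → Type*} [∀ n, MeasurableSpace (Y n)]
  (B : ∀ n, BayesModel (d n) (Y n)) (P₀ : ∀ n, Measure (Y n))
  (θs : ∀ n, Par (d n)) (map : ∀ n, Y n → Par (d n))

/-- `P_{θ*}` is, for every `n`, the unique Kullback–Leibler projection of the true law `P₀` onto
the model. -/
def UniqueKLProjection : Prop :=
  ∀ n, θs n ∈ (B n).Θ ∧ ∀ θ ∈ (B n).Θ,
    InformationTheory.klDiv (P₀ n) ((B n).law (θs n))
        ≤ InformationTheory.klDiv (P₀ n) ((B n).law θ) ∧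
    (InformationTheory.klDiv (P₀ n) ((B n).law θ)
        = InformationTheory.klDiv (P₀ n) ((B n).law (θs n)) → (B n).law θ = (B n).law (θs n))

/-- The log-prior is `C⁴` on a neighbourhood (inside `Θ`) of `θ*` whose size does not depend on
`n`, and `0 < π(θ*) < ∞`.  As the dimension may vary with `n`, positivity at `θ*` is
quantified by `π(θ*) ≥ n^{-C d}`; for a prior that does not vary with `n` this is just
`0 < π(θ*)`, see `priorRegular_of_fixed`. -/
def PriorRegular : Prop :=
  (∃ r : ℝ, 0 < r ∧ ∀ n, Metric.ball (θs n) r ⊆ (B n).Θ ∧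
    (∀ θ ∈ Metric.ball (θs n) r, 0 < (B n).prior θ) ∧
    ContDiffOn ℝ 4 (B n).logPrior (Metric.ball (θs n) r)) ∧
  ∃ C : ℝ, ∀ᶠ n : ℕ in atTop, (n : ℝ) ^ (-(C * d n)) ≤ (B n).prior (θs n)

/-- For every `M_n → ∞` there is `c₁ > 0` such that, with probability tending to one,
`sup_{‖θ - θ*‖ > M_n √d / √n} (ℓ(θ) - ℓ(θ*)) / n < - c₁ M_n² d / n`. -/
def LikelihoodSeparation : Prop :=
  ∀ M : ℕ → ℝ, Tendsto M atTop atTop → ∃ c₁ : ℝ, 0 < c₁ ∧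
    WithProbToOne P₀ (fun n => {y |
      (⨆ θ ∈ {θ : Par (d n) | θ ∈ (B n).Θ ∧
          M n * Real.sqrt (d n) / Real.sqrt n < ‖θ - θs n‖},
        ((B n).elogLik y θ - (B n).elogLik y (θs n)) / ((n : ℝ) : EReal))
      < ((-c₁ * M n ^ 2 * d n / n : ℝ) : EReal)})

/-- `map n` is a MAP estimator with `E‖map - θ*‖² = O(d/n)`. -/
def MAPConsistent : Prop :=
  (∀ n, Measurable (map n)) ∧ (∀ n, ∀ᵐ y ∂(P₀ n), (B n).IsMAP y (map n y)) ∧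
  ∃ C : ℝ, ∀ᶠ n : ℕ in atTop,
    ∫⁻ y, ENNReal.ofReal (‖map n y - θs n‖ ^ 2) ∂(P₀ n) ≤ ENNReal.ofReal (C * (d n / n))

/-- There are `η₁, η₂ > 0` such that, with probability tending to one, all the eigenvalues of
`J / n` at the MAP lie in `(η₁, η₂)`. -/
def HessianBounded : Prop :=
  ∃ η₁ η₂ : ℝ, 0 < η₁ ∧ 0 < η₂ ∧ WithProbToOne P₀ (fun n => {y |
    ∃ h : ((n : ℝ)⁻¹ • (B n).negHess y (map n y)).IsHermitian,
      ∀ i, η₁ < h.eigenvalues i ∧ h.eigenvalues i < η₂})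

/-- With probability tending to one, on the `δ`-ball around the MAP the log-likelihood is finite
and `C^j`, the log-prior is finite and `C^k`, and the bounds
`‖ℓ⁽ⁱ⁾(θ)/n‖ < L`, `3 ≤ i ≤ j`, and `‖(log π)⁽ⁱ⁾(θ)‖ < L`, `2 ≤ i ≤ k`, hold in spectral norm.
(The points of the ball interior to `Θ` are those where the derivatives make sense.) -/
def DerivativesBounded (j k : ℕ) (δ L : ℝ) : Prop :=
  WithProbToOne P₀ (fun n => {y |
    ∀ θ ∈ interior (B n).Θ, ‖map n y - θ‖ < δ →
      (0 < (B n).lik θ y ∧ ContDiffAt ℝ j ((B n).logLik y) θ ∧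
        ∀ i, 3 ≤ i → i ≤ j → ‖iteratedFDeriv ℝ i ((B n).logLik y) θ‖ / n < L) ∧
      (0 < (B n).prior θ ∧ ContDiffAt ℝ k (B n).logPrior θ ∧
        ∀ i, 2 ≤ i → i ≤ k → ‖iteratedFDeriv ℝ i (B n).logPrior θ‖ < L)})

end Assumptions

/-- For a parameter space, prior and `θ*` that do not depend on `n`, `PriorRegular` is the usual
local condition at `θ*`. -/
theorem priorRegular_of_fixed {d₀ : ℕ} (hd : 0 < d₀) {Y : ℕ → Type*}
    [∀ n, MeasurableSpace (Y n)] (B : ∀ n, BayesModel d₀ (Y n)) (Θ : Set (Par d₀))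
    (p : Par d₀ → ℝ) (θ₀ : Par d₀) (hΘ : ∀ n, (B n).Θ = Θ) (hp : ∀ n, (B n).prior = p)
    (U : Set (Par d₀)) (hU : U ∈ 𝓝 θ₀) (hUΘ : U ⊆ Θ) (hpos : ∀ θ ∈ U, 0 < p θ)
    (hsm : ContDiffOn ℝ 4 (fun θ => Real.log (p θ)) U) :
    PriorRegular (d := fun _ => d₀) B (fun _ => θ₀) := by
  obtain ⟨r, hr, hrU⟩ := Metric.mem_nhds_iff.1 hU
  refine ⟨⟨r, hr, fun n => ⟨?_, ?_, ?_⟩⟩, 1, ?_⟩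
  · rw [hΘ n]; exact hrU.trans hUΘ
  · intro θ hθ; rw [hp n]; exact hpos θ (hrU hθ)
  · have : (B n).logPrior = fun θ => Real.log (p θ) := by
      funext θ; simp [BayesModel.logPrior, hp n]
    rw [this]; exact hsm.mono hrU
  · have h1 : Tendsto (fun n : ℕ => (n : ℝ) ^ (-(1 * (d₀ : ℝ)))) atTop (𝓝 0) :=
      (tendsto_rpow_neg_atTop (by simpa using hd)).comp tendsto_natCast_atTop_atTop
    have h2 : 0 < p θ₀ := hpos θ₀ (mem_of_mem_nhds hU)
    filter_upwards [h1.eventually_lt_const h2] with n hn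
    rw [hp n]; exact hn.le

end

/-! The posterior equals twice its symmetrisation about the mode times the skewness factor, and
`skewPerturb` multiplies `f` by that same factor, which lies in `[0, 1]`. The total variation
distance is therefore at most the L¹ distance between the symmetrised posterior and the symmetric
density `f`, and all odd terms of the expansion are averaged away.

Let `R = 2 log n √(d/n)` and `τ ≍ n R³`. On the ball of radius `R` around the mode, the
log-posterior minus its quadratic part has a cubic likelihood term `O(τ)`, a quartic one `O(τ²)`, a
quintic one and a cubic prior term `O(τ³)`, and a remainder `O(τ⁴)`. Averaging the exponentials at
`v` and `-v` gives `1 + O(τ²)`, or `P(v) + O(τ⁴)` under the stronger smoothness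
(`IsMAP.local_expansion_two`, `IsMAP.local_expansion_four`). Since `τ² ≍ (log n)⁶ d³ / n`, these are
the two rates.

Outside the ball, likelihood separation with `M = log n` makes the posterior mass at most `exp(-c₁
(log n)² d)` relative to the likelihood at `θ*`. This beats the lower bound `n^{-Cd}` on the prior
and the Gaussian normaliser, of order `n^{-d/2}` up to a factor exponential in `d`, with `n⁻²` to
spare; the Gaussian tail is handled alike. `IsMAP.tvDist_le` combines ball and tails for a fixed
sample. If the rate exceeds a fixed threshold `κ`, the crude bound `2` on the distance suffices. The
constants depend on neither `n` nor `d`, and the probabilistic part only shows that the good sample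
event has probability tending to one. -/

/-! ### Taylor expansion along a segment. -/

/-- The derivative of the order `N + 1` remainder is the order `N` remainder of the shifted family,
so induction and the mean value inequality suffice. No continuity of the top derivative is needed.
-/
theorem abs_sub_taylor_le {B : ℝ} (N : ℕ) (φ : ℕ → ℝ → ℝ)
    (h : ∀ k < N, ∀ t ∈ Icc (0 : ℝ) 1, HasDerivAt (φ k) (φ (k + 1) t) t)
    (hB : ∀ t ∈ Icc (0 : ℝ) 1, |φ N t| ≤ B) :
    ∀ t ∈ Icc (0 : ℝ) 1,
      |φ 0 t - ∑ k ∈ Finset.range N, φ k 0 * t ^ k / (k.factorial : ℝ)|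
        ≤ B * t ^ N / (N.factorial : ℝ) := by
  induction N generalizing φ with
  | zero => intro t ht; simpa using hB t ht
  | succ N ih =>
    have ih' := ih (fun k => φ (k + 1)) (fun k hk t ht => h (k + 1) (by omega) t ht) hB
    have hfac : ∀ k : ℕ, ((k + 1).factorial : ℝ) = (k + 1) * (k.factorial : ℝ) := by
      intro k; push_cast [Nat.factorial_succ]; ring
    have hpow : ∀ (c : ℝ) (k : ℕ) (x : ℝ),
        HasDerivAt (fun t : ℝ => c * t ^ (k + 1) / ((k + 1).factorial : ℝ))
          (c * x ^ k / (k.factorial : ℝ)) x := by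
      intro c k x
      have h1 := ((hasDerivAt_pow (k + 1) x).const_mul c).div_const ((k + 1).factorial : ℝ)
      refine h1.congr_deriv ?_
      rw [hfac]
      have : (k.factorial : ℝ) ≠ 0 := by positivity
      have h2 : (k : ℝ) + 1 ≠ 0 := by positivity
      push_cast
      field_simp
    have hder : ∀ x ∈ Icc (0 : ℝ) 1, HasDerivAt
        (fun t => φ 0 t - ∑ k ∈ Finset.range (N + 1), φ k 0 * t ^ k / (k.factorial : ℝ))
        (φ 1 x - ∑ k ∈ Finset.range N, φ (k + 1) 0 * x ^ k / (k.factorial : ℝ)) x := by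
      intro x hx
      have h1 : HasDerivAt
          (fun t : ℝ => ∑ k ∈ Finset.range N, φ (k + 1) 0 * t ^ (k + 1) / ((k + 1).factorial : ℝ))
          (∑ k ∈ Finset.range N, φ (k + 1) 0 * x ^ k / (k.factorial : ℝ)) x :=
        HasDerivAt.fun_sum fun k _ => hpow _ k x
      have h2 := (h 0 (by omega) x hx).sub (h1.add_const (φ 0 0))
      refine h2.congr_of_eventuallyEq (Eventually.of_forall fun t => ?_)
      simp [Finset.sum_range_succ']
    intro t ht
    have := image_norm_le_of_norm_deriv_right_le_deriv_boundary
      (a := 0) (b := 1)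
      (fun x hx => (hder x hx).continuousAt.continuousWithinAt)
      (fun x hx => (hder x (Ico_subset_Icc_self hx)).hasDerivWithinAt)
      (B := fun t => B * t ^ (N + 1) / ((N + 1).factorial : ℝ)) (by simp [Finset.sum_range_succ'])
      (fun x => hpow B N x)
      (fun x hx => ih' x (Ico_subset_Icc_self hx)) ht
    simpa using this

section Line

variable {E : Type*} [NormedAddCommGroup E] [NormedSpace ℝ E]

theorem hasDerivAt_iteratedFDeriv_line {f : E → ℝ} {m v : E} {t : ℝ} {k : ℕ}
    (hf : ContDiffAt ℝ (k + 1 : ℕ) f (m + t • v)) :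
    HasDerivAt (fun s : ℝ => iteratedFDeriv ℝ k f (m + s • v) fun _ => v)
      (iteratedFDeriv ℝ (k + 1) f (m + t • v) fun _ => v) t := by
  have h1 : DifferentiableAt ℝ (iteratedFDeriv ℝ k f) (m + t • v) :=
    hf.differentiableAt_iteratedFDeriv (by exact_mod_cast Nat.lt_succ_self k)
  have h2 : HasDerivAt (fun s : ℝ => m + s • v) v t := by
    simpa using ((hasDerivAt_id t).smul_const v).const_add m
  have h3 := h1.hasFDerivAt.comp_hasDerivAt t h2
  have h4 := (ContinuousMultilinearMap.apply ℝ (fun _ : Fin k => E) ℝ fun _ => v).hasFDerivAt.comp_hasDerivAt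
    t h3
  rw [iteratedFDeriv_succ_apply_left]
  exact h4

theorem abs_iteratedFDeriv_const_le (f : E → ℝ) (x v : E) (k : ℕ) :
    |iteratedFDeriv ℝ k f x fun _ => v| ≤ ‖iteratedFDeriv ℝ k f x‖ * ‖v‖ ^ k := by
  simpa using (iteratedFDeriv ℝ k f x).le_opNorm fun _ => v

theorem abs_sub_taylor_line_le {f : E → ℝ} {m v : E} {B : ℝ} (N : ℕ)
    (hf : ∀ t ∈ Icc (0 : ℝ) 1, ContDiffAt ℝ N f (m + t • v))
    (hB : ∀ t ∈ Icc (0 : ℝ) 1, ‖iteratedFDeriv ℝ N f (m + t • v)‖ ≤ B) :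
    |f (m + v) - ∑ k ∈ Finset.range N,
        (iteratedFDeriv ℝ k f m fun _ => v) / (k.factorial : ℝ)|
      ≤ B * ‖v‖ ^ N / (N.factorial : ℝ) := by
  have := abs_sub_taylor_le (B := B * ‖v‖ ^ N) N
    (fun k t => iteratedFDeriv ℝ k f (m + t • v) fun _ => v)
    (fun k hk t ht => hasDerivAt_iteratedFDeriv_line
      ((hf t ht).of_le (by exact_mod_cast hk)))
    (fun t ht => (abs_iteratedFDeriv_const_le _ _ _ _).trans
      (mul_le_mul_of_nonneg_right (hB t ht) (by positivity))) 1 (by simp)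
  simpa using this

theorem iteratedFDeriv_const_neg (f : E → ℝ) (x v : E) (k : ℕ) :
    (iteratedFDeriv ℝ k f x fun _ => -v) = (-1) ^ k * iteratedFDeriv ℝ k f x fun _ => v := by
  have := (iteratedFDeriv ℝ k f x).toMultilinearMap.map_smul_univ (fun _ => (-1 : ℝ)) (fun _ => v)
  simpa using this

end Line

/-! ### Averages of two exponentials with nearly opposite exponents. -/

theorem Real.abs_exp_sub_cubic_le {x : ℝ} (hx : |x| ≤ 1) :
    |Real.exp x - (1 + x + x ^ 2 / 2 + x ^ 3 / 6)| ≤ x ^ 4 := by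
  have h := Real.exp_bound hx (n := 4) (by norm_num)
  have h4 : |x| ^ 4 = x ^ 4 := by
    rw [show (4 : ℕ) = 2 * 2 by norm_num, pow_mul, sq_abs, ← pow_mul]
  simp only [Finset.sum_range_succ, Finset.sum_range_zero, h4] at h
  norm_num [Nat.factorial] at h
  refine (h.trans ?_)
  nlinarith [sq_nonneg (x ^ 2)]

/-- Second-order symmetrisation: the odd part cancels. -/
theorem abs_symm_exp_sub_one_le {τ b x y : ℝ} (hτ : τ ≤ 1 / 4) (hτ0 : 0 ≤ τ)
    (hb : |b| ≤ τ) (hx : |x - b| ≤ τ ^ 2) (hy : |y + b| ≤ τ ^ 2) :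
    |(Real.exp x + Real.exp y) / 2 - 1| ≤ 6 * τ ^ 2 := by
  have hτ2 : τ ^ 2 ≤ τ := by nlinarith
  rw [abs_le] at hb hx hy
  have hx1 : |x| ≤ 2 * τ := abs_le.2 ⟨by linarith, by linarith⟩
  have hy1 : |y| ≤ 2 * τ := abs_le.2 ⟨by linarith, by linarith⟩
  -- In the average, the linear part is `(x + y) / 2`, where `b` cancels and at most `τ²` is left;
  -- each quadratic remainder is at most `4τ²`.
  have h1 := Real.abs_exp_sub_one_sub_id_le (x := x) (by linarith)
  have h2 := Real.abs_exp_sub_one_sub_id_le (x := y) (by linarith)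
  have h3 : x ^ 2 ≤ (2 * τ) ^ 2 := sq_le_sq' (by linarith [(abs_le.1 hx1).1]) (abs_le.1 hx1).2
  have h4 : y ^ 2 ≤ (2 * τ) ^ 2 := sq_le_sq' (by linarith [(abs_le.1 hy1).1]) (abs_le.1 hy1).2
  rw [abs_le] at h1 h2 ⊢
  constructor <;> nlinarith

/-- Fourth-order symmetrisation. -/
theorem abs_symm_exp_sub_poly_le {τ a b c x y : ℝ} (hτ : τ ≤ 1 / 4) (hτ0 : 0 ≤ τ)
    (hb : |b| ≤ τ) (ha : |a| ≤ τ ^ 2) (hc : |c| ≤ τ ^ 3)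
    (hx : |x - (b + a + c)| ≤ τ ^ 4) (hy : |y - (-b + a - c)| ≤ τ ^ 4) :
    |(Real.exp x + Real.exp y) / 2 - (1 + a + a ^ 2 / 2 + b ^ 2 / 2)| ≤ 100 * τ ^ 4 := by
  -- Odd and even parts of the exponents: `p = b + O(τ³)` and `q = a + O(τ⁴)`. The odd term `c`
  -- enters only through `p² - b²`, which is `O(τ⁴)`.
  obtain ⟨p, hp⟩ : ∃ p, p = (x - y) / 2 := ⟨_, rfl⟩
  obtain ⟨q, hq⟩ : ∃ q, q = (x + y) / 2 := ⟨_, rfl⟩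
  have hxe : x = q + p := by rw [hp, hq]; ring
  have hye : y = q - p := by rw [hp, hq]; ring
  have t2 : τ ^ 2 ≤ τ / 4 := by nlinarith
  have t3 : τ ^ 3 ≤ τ ^ 2 / 4 := by nlinarith [sq_nonneg τ]
  have t4 : τ ^ 4 ≤ τ ^ 3 / 4 := by nlinarith [pow_nonneg hτ0 3]
  have t30 := pow_nonneg hτ0 3
  have t40 := pow_nonneg hτ0 4
  rw [hxe, abs_le] at hx
  rw [hye, abs_le] at hy
  rw [abs_le] at ha hb hc
  have hpb : |p - b| ≤ 2 * τ ^ 3 := abs_le.2 ⟨by linarith, by linarith⟩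
  have hpb' : |p + b| ≤ 3 * τ := abs_le.2 ⟨by linarith, by linarith⟩
  have hqa : |q - a| ≤ τ ^ 4 := abs_le.2 ⟨by linarith, by linarith⟩
  have hqa' : |q + a| ≤ 1 := abs_le.2 ⟨by linarith, by linarith⟩
  have hp2 : |p| ≤ 2 * τ := abs_le.2 ⟨by linarith, by linarith⟩
  have hq2 : |q| ≤ 2 * τ ^ 2 := abs_le.2 ⟨by linarith, by linarith⟩
  have hxa : |x| ≤ 2 * τ := by
    rw [hxe]; exact abs_le.2 ⟨by linarith, by linarith⟩
  have hya : |y| ≤ 2 * τ := by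
    rw [hye]; exact abs_le.2 ⟨by linarith, by linarith⟩
  have fourth : ∀ z : ℝ, |z| ≤ 2 * τ → z ^ 4 ≤ 16 * τ ^ 4 := by
    intro z hz
    have := pow_le_pow_left₀ (abs_nonneg z) hz 4
    rw [Even.pow_abs (by decide)] at this
    linarith [mul_pow 2 τ 4]
  have ex := (Real.abs_exp_sub_cubic_le (x := x) (by linarith)).trans (fourth x hxa)
  have ey := (Real.abs_exp_sub_cubic_le (x := y) (by linarith)).trans (fourth y hya)
  have m1 : |(p - b) * (p + b)| ≤ 2 * τ ^ 3 * (3 * τ) := by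
    rw [abs_mul]; exact mul_le_mul hpb hpb' (abs_nonneg _) (by positivity)
  have m2 : |(q - a) * (q + a)| ≤ τ ^ 4 * 1 := by
    rw [abs_mul]; exact mul_le_mul hqa hqa' (abs_nonneg _) (by positivity)
  have m3 : |q * (q ^ 2 + 3 * p ^ 2)| ≤ 2 * τ ^ 2 * (16 * τ ^ 2) := by
    rw [abs_mul]
    refine mul_le_mul hq2 ?_ (abs_nonneg _) (by positivity)
    have h1 : p ^ 2 ≤ (2 * τ) ^ 2 := sq_le_sq' (abs_le.1 hp2).1 (abs_le.1 hp2).2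
    have h2 : q ^ 2 ≤ (2 * τ ^ 2) ^ 2 := sq_le_sq' (abs_le.1 hq2).1 (abs_le.1 hq2).2
    rw [abs_of_nonneg (by positivity)]
    linarith [mul_le_mul_of_nonneg_left t2 (sq_nonneg τ), mul_le_mul_of_nonneg_left hτ (pow_nonneg hτ0 3), sq_nonneg τ]
  -- The cubic Taylor polynomials average to `1 + q + (q² + p²)/2 + q(q² + 3p²)/6`, whose last term
  -- is already `O(τ⁴)`.
  have key : (Real.exp x + Real.exp y) / 2 - (1 + a + a ^ 2 / 2 + b ^ 2 / 2)
      = (Real.exp x - (1 + x + x ^ 2 / 2 + x ^ 3 / 6)) / 2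
        + (Real.exp y - (1 + y + y ^ 2 / 2 + y ^ 3 / 6)) / 2
        + (q - a) + (p - b) * (p + b) / 2 + (q - a) * (q + a) / 2
        + q * (q ^ 2 + 3 * p ^ 2) / 6 := by
    rw [hp, hq]; ring
  rw [key]
  rw [abs_le] at ex ey m1 m2 m3 hqa ⊢
  constructor <;> linarith

/-! ### Quadratic forms and Gaussian integrals. -/

/-- The quadratic form `v ↦ ⟨v, A v⟩`. -/
def quadForm {d : ℕ} (A : Matrix (Fin d) (Fin d) ℝ) (v : Par d) : ℝ :=
  (fun i => v i) ⬝ᵥ (A.mulVec (fun i => v i))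

section QuadForm

variable {d : ℕ} {A : Matrix (Fin d) (Fin d) ℝ}

theorem continuous_quadForm (A : Matrix (Fin d) (Fin d) ℝ) : Continuous (quadForm A) := by
  unfold quadForm
  simp only [dotProduct, Matrix.mulVec]
  fun_prop

theorem quadForm_smul_arg (c : ℝ) (v : Par d) : quadForm A (c • v) = c ^ 2 * quadForm A v := by
  unfold quadForm
  simp only [dotProduct, Matrix.mulVec, Finset.mul_sum, PiLp.smul_apply, smul_eq_mul]
  exact Finset.sum_congr rfl fun i _ => Finset.sum_congr rfl fun j _ => by ring

theorem quadForm_neg (v : Par d) : quadForm A (-v) = quadForm A v := by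
  simpa using quadForm_smul_arg (A := A) (-1) v

theorem quadForm_smul (c : ℝ) (v : Par d) : quadForm (c • A) v = c * quadForm A v := by
  simp [quadForm, Matrix.smul_mulVec, dotProduct_smul]

theorem quadForm_eq_sum_eigenvalues (hA : A.IsHermitian) (v : Par d) :
    quadForm A v = ∑ i, hA.eigenvalues i * (hA.eigenvectorBasis.repr v i) ^ 2 := by
  have hv := hA.eigenvectorBasis.sum_repr v
  have hv' : (fun i => v i) = ∑ i, hA.eigenvectorBasis.repr v i • (hA.eigenvectorBasis i).ofLp := by
    conv_lhs => rw [← hv]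
    ext j; simp
  have hmul : A.mulVec (fun i => v i) = ∑ i, (hA.eigenvectorBasis.repr v i * hA.eigenvalues i) •
      (hA.eigenvectorBasis i).ofLp := by
    rw [hv', Matrix.mulVec_sum]
    refine Finset.sum_congr rfl fun i _ => ?_
    rw [Matrix.mulVec_smul, hA.mulVec_eigenvectorBasis, smul_smul]
  unfold quadForm
  rw [hmul, dotProduct_sum]
  refine Finset.sum_congr rfl fun i _ => ?_
  have : (fun i => v i) ⬝ᵥ (hA.eigenvectorBasis i).ofLp = hA.eigenvectorBasis.repr v i := by
    rw [OrthonormalBasis.repr_apply_apply]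
    simp [PiLp.inner_apply, dotProduct]
  rw [dotProduct_smul, this, smul_eq_mul]
  ring

theorem sum_repr_sq (b : OrthonormalBasis (Fin d) ℝ (Par d)) (v : Par d) :
    ∑ i, (b.repr v i) ^ 2 = ‖v‖ ^ 2 := by
  rw [← b.repr.norm_map v, EuclideanSpace.norm_sq_eq]
  simp

theorem le_quadForm {η : ℝ} (hA : A.IsHermitian) (h : ∀ i, η ≤ hA.eigenvalues i) (v : Par d) :
    η * ‖v‖ ^ 2 ≤ quadForm A v := by
  rw [quadForm_eq_sum_eigenvalues hA, ← sum_repr_sq hA.eigenvectorBasis v, Finset.mul_sum]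
  exact Finset.sum_le_sum fun i _ => mul_le_mul_of_nonneg_right (h i) (sq_nonneg _)

theorem quadForm_le {η : ℝ} (hA : A.IsHermitian) (h : ∀ i, hA.eigenvalues i ≤ η) (v : Par d) :
    quadForm A v ≤ η * ‖v‖ ^ 2 := by
  rw [quadForm_eq_sum_eigenvalues hA, ← sum_repr_sq hA.eigenvectorBasis v, Finset.mul_sum]
  exact Finset.sum_le_sum fun i _ => mul_le_mul_of_nonneg_right (h i) (sq_nonneg _)

/-- In the orthonormal eigenbasis the integrand is a product of one-dimensional Gaussians, and
rotation preserves volume. -/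
theorem integral_exp_neg_quadForm (hA : A.PosDef) :
    ∫ v, Real.exp (-(1 / 2) * quadForm A v) = Real.sqrt ((2 * Real.pi) ^ d * (A⁻¹).det) := by
  have hH := hA.isHermitian
  have h1 : ∀ v : Par d, Real.exp (-(1 / 2) * quadForm A v)
      = ∏ i, Real.exp (-(hH.eigenvalues i / 2) * ((hH.eigenvectorBasis.repr v).ofLp i) ^ 2) := by
    intro v
    rw [← Real.exp_sum, quadForm_eq_sum_eigenvalues hH, Finset.mul_sum]
    congr 1
    exact Finset.sum_congr rfl fun i _ => by ring
  simp only [h1]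
  have h2 := hH.eigenvectorBasis.measurePreserving_measurableEquiv.integral_comp'
    (fun x : Par d => ∏ i, Real.exp (-(hH.eigenvalues i / 2) * (x.ofLp i) ^ 2))
  refine Eq.trans h2 ?_
  have h3 := (EuclideanSpace.volume_preserving_symm_measurableEquiv_toLp (Fin d)).integral_comp'
    (fun x : Fin d → ℝ => ∏ i, Real.exp (-(hH.eigenvalues i / 2) * (x i) ^ 2))
  refine Eq.trans h3 ?_
  rw [integral_fintype_prod_volume_eq_prod
    (fun i x => Real.exp (-(hH.eigenvalues i / 2) * x ^ 2))]
  simp only [integral_gaussian]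
  have hpos := hA.eigenvalues_pos
  have hdet : A.det = ∏ i, hH.eigenvalues i := by simpa using hH.det_eq_prod_eigenvalues
  rw [Matrix.det_nonsing_inv, hdet, Ring.inverse_eq_inv', ← Finset.prod_inv_distrib]
  have : (2 * Real.pi) ^ d = ∏ _i : Fin d, (2 * Real.pi) := by simp
  rw [this, ← Finset.prod_mul_distrib, Real.sqrt_prod _ fun i _ => ?_]
  · refine Finset.prod_congr rfl fun i _ => ?_
    congr 1
    field_simp
  · have := hpos i
    have := Real.pi_pos
    positivity

theorem integrable_exp_neg_mul_norm_sq {b : ℝ} (hb : 0 < b) :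
    Integrable fun v : Par d => Real.exp (-b * ‖v‖ ^ 2) := by
  have := (GaussianFourier.integrable_cexp_neg_mul_sq_norm_add (V := Par d) (b := (b : ℂ))
    (by simpa using hb) 0 0).norm
  simpa [Complex.norm_exp, ← Complex.ofReal_pow] using this

theorem integrable_exp_neg_quadForm {η c : ℝ} (hη : 0 < η) (hc : 0 < c)
    (h : ∀ v, η * ‖v‖ ^ 2 ≤ quadForm A v) :
    Integrable fun v : Par d => Real.exp (-c * quadForm A v) := by
  refine (integrable_exp_neg_mul_norm_sq (d := d) (mul_pos hc hη)).mono'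
    (Real.continuous_exp.comp ((continuous_quadForm A).const_mul (-c))).aestronglyMeasurable ?_
  refine Eventually.of_forall fun v => ?_
  rw [Real.norm_of_nonneg (Real.exp_pos _).le]
  exact Real.exp_le_exp.2 (by nlinarith [h v])

theorem le_integral_exp_neg_quadForm {η η' : ℝ} (hη : 0 < η) (hη' : 0 < η')
    (h : ∀ v, η * ‖v‖ ^ 2 ≤ quadForm A v) (h' : ∀ v, quadForm A v ≤ η' * ‖v‖ ^ 2) :
    (2 * Real.pi / η') ^ ((d : ℝ) / 2) ≤ ∫ v, Real.exp (-(1 / 2) * quadForm A v) := by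
  have h1 := GaussianFourier.integral_rexp_neg_mul_sq_norm (V := Par d) (b := η' / 2) (by positivity)
  have h2 : Real.pi / (η' / 2) = 2 * Real.pi / η' := by field_simp
  rw [h2, finrank_euclideanSpace_fin] at h1
  rw [← h1]
  refine integral_mono (integrable_exp_neg_mul_norm_sq (by positivity)) ?_ fun v => ?_
  · exact integrable_exp_neg_quadForm hη (by norm_num) h
  · exact Real.exp_le_exp.2 (by nlinarith [h' v])

/-- Rescaling by `√2` turns one exponent into the other. The factor `√2 ^ d` is the price paid in
tail bounds for giving up half of the exponent. -/
theorem integral_exp_neg_quadForm_quarter :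
    ∫ v, Real.exp (-(1 / 4) * quadForm A v)
      = Real.sqrt 2 ^ d * ∫ v, Real.exp (-(1 / 2) * quadForm A v) := by
  have h := Measure.integral_comp_smul (volume : Measure (Par d))
    (fun v => Real.exp (-(1 / 4) * quadForm A v)) (Real.sqrt 2)
  have h2 : ∀ v : Par d, -(1 / 4) * quadForm A (Real.sqrt 2 • v) = -(1 / 2) * quadForm A v := by
    intro v
    rw [quadForm_smul_arg, Real.sq_sqrt (by norm_num)]
    ring
  simp only [h2, finrank_euclideanSpace_fin, smul_eq_mul] at h
  have hp : 0 < Real.sqrt 2 ^ d := by positivity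
  rw [h, abs_of_pos (inv_pos.2 hp), mul_inv_cancel_left₀ hp.ne']

end QuadForm

theorem gaussDensity_inv {d : ℕ} {A : Matrix (Fin d) (Fin d) ℝ} (hA : A.PosDef) (m θ : Par d) :
    gaussDensity m A⁻¹ θ
      = Real.exp (-(1 / 2) * quadForm A (θ - m)) / ∫ v, Real.exp (-(1 / 2) * quadForm A v) := by
  rw [integral_exp_neg_quadForm hA, gaussDensity,
    Matrix.nonsing_inv_nonsing_inv _ hA.det_pos.ne'.isUnit]
  exact (div_eq_inv_mul _ _).symm

/-! ### L¹ effect of normalising constants. -/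

section Normalisation

variable {X : Type*} [MeasurableSpace X] {ν : Measure X}

/-- The two normalising constants differ by at most the L¹ distance of the kernels, so normalising
at most doubles the relative error. -/
theorem integral_abs_div_integral_sub_le {a b : X → ℝ} (ha : Integrable a ν) (hb : Integrable b ν)
    (ha0 : ∀ x, 0 ≤ a x) (hB : 0 < ∫ x, b x ∂ν) :
    ∫ x, |a x / (∫ t, a t ∂ν) - b x / (∫ t, b t ∂ν)| ∂ν
      ≤ 2 * (∫ x, |a x - b x| ∂ν) / ∫ t, b t ∂ν := by
  set A := ∫ t, a t ∂ν with hA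
  set B := ∫ t, b t ∂ν with hBdef
  have hA0 : 0 ≤ A := integral_nonneg ha0
  have hAB : |B - A| ≤ ∫ x, |a x - b x| ∂ν := by
    rw [hA, hBdef, ← integral_sub hb ha]
    refine (abs_integral_le_integral_abs).trans (le_of_eq ?_)
    exact integral_congr_ae (Eventually.of_forall fun x => abs_sub_comm _ _)
  have h1 : ∀ x, |a x / A - b x / B| ≤ |a x - b x| / B + a x * |1 / A - 1 / B| := by
    intro x
    have : a x / A - b x / B = (a x - b x) / B + a x * (1 / A - 1 / B) := by ring
    rw [this]
    refine (abs_add_le _ _).trans (le_of_eq ?_)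
    rw [abs_div, abs_of_pos hB, abs_mul, abs_of_nonneg (ha0 x)]
  have hi1 : Integrable (fun x => |a x - b x| / B) ν := (ha.sub hb).abs.div_const B
  have hi2 : Integrable (fun x => a x * |1 / A - 1 / B|) ν := ha.mul_const _
  have h2 : A * |1 / A - 1 / B| ≤ |B - A| / B := by
    -- Only the integral of `b` is assumed positive; a zero integral of `a` makes the left side
    -- vanish.
    rcases hA0.eq_or_lt with h0 | h0
    · rw [← h0, zero_mul]; positivity
    · have : 1 / A - 1 / B = (B - A) / (A * B) := by field_simp
      rw [this, abs_div, abs_of_pos (mul_pos h0 hB)]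
      apply le_of_eq
      field_simp
  calc ∫ x, |a x / A - b x / B| ∂ν
      ≤ ∫ x, (|a x - b x| / B + a x * |1 / A - 1 / B|) ∂ν :=
        integral_mono ((ha.div_const A).sub (hb.div_const B)).abs (hi1.add hi2) h1
    _ = (∫ x, |a x - b x| ∂ν) / B + A * |1 / A - 1 / B| := by
        rw [integral_add hi1 hi2, integral_div, integral_mul_const]
    _ ≤ (∫ x, |a x - b x| ∂ν) / B + (∫ x, |a x - b x| ∂ν) / B := by
        gcongr
        exact h2.trans (by gcongr)
    _ = 2 * (∫ x, |a x - b x| ∂ν) / B := by ring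

theorem lintegral_ofReal_div_integral_le_one {h : X → ℝ} (h0 : ∀ x, 0 ≤ h x) :
    ∫⁻ x, ENNReal.ofReal (h x / ∫ t, h t ∂ν) ∂ν ≤ 1 := by
  -- For non-integrable `h` the Bochner integral is `0`, so every quotient is `0`.
  by_cases hi : Integrable h ν
  · rw [← ofReal_integral_eq_lintegral_ofReal (hi.div_const _)
      (Eventually.of_forall fun x => div_nonneg (h0 x) (integral_nonneg h0)), integral_div]
    exact ENNReal.ofReal_le_one.2 (div_self_le_one _)
  · simp [integral_undef hi]

end Normalisation

/-! ### Reduction to the symmetrised posterior. -/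

namespace BayesModel

variable {d : ℕ} {Y : Type*} [MeasurableSpace Y] (B : BayesModel d Y)

theorem unnormPost_nonneg (y : Y) (θ : Par d) : 0 ≤ B.unnormPost y θ :=
  indicator_nonneg (fun _ _ => mul_nonneg (B.prior_nonneg _) (B.lik_nonneg _ _)) θ

theorem measurable_unnormPost (y : Y) : Measurable (B.unnormPost y) :=
  (B.measurable_prior.mul (B.measurable_lik.comp measurable_prodMk_right)).indicator
    B.measurableSet_Θ

theorem unnormPost_of_mem {y : Y} {θ : Par d} (h : θ ∈ B.Θ) :
    B.unnormPost y θ = B.prior θ * B.lik θ y := indicator_of_mem h _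

theorem skewFactor_nonneg (y : Y) (m θ : Par d) : 0 ≤ B.skewFactor y m θ := by
  unfold skewFactor
  split_ifs
  · norm_num
  · exact div_nonneg (B.unnormPost_nonneg y _)
      (add_nonneg (B.unnormPost_nonneg y _) (B.unnormPost_nonneg y _))

theorem skewFactor_le_one (y : Y) (m θ : Par d) : B.skewFactor y m θ ≤ 1 := by
  unfold skewFactor
  split_ifs
  · norm_num
  · exact div_le_one_of_le₀ (le_add_of_nonneg_right (B.unnormPost_nonneg y _))
      (add_nonneg (B.unnormPost_nonneg y _) (B.unnormPost_nonneg y _))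

theorem unnormPost_eq_mul_skewFactor (y : Y) (m θ : Par d) :
    B.unnormPost y θ
      = (B.unnormPost y θ + B.unnormPost y ((2 : ℝ) • m - θ)) * B.skewFactor y m θ := by
  unfold skewFactor
  split_ifs with h
  · simp [h.1, h.2]
  · rw [mul_div_cancel₀]
    intro h0
    have h1 := B.unnormPost_nonneg y θ
    have h2 := B.unnormPost_nonneg y ((2 : ℝ) • m - θ)
    exact h ⟨by linarith, by linarith⟩

/-- Only the symmetrised posterior matters for the total variation distance between the posterior
and a skew-symmetric perturbation. -/
theorem tvDist_post_skewPerturb_le {y : Y} (m : Par d) (f : Par d → ℝ) {c : ℝ} (hc : 0 < c)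
    (hF : Integrable (B.unnormPost y)) :
    tvDist (B.post y) (B.skewPerturb y m f)
      ≤ ∫⁻ θ, ENNReal.ofReal
        |(B.unnormPost y θ + B.unnormPost y ((2 : ℝ) • m - θ)) / 2 / c
          / (∫ t, (B.unnormPost y t + B.unnormPost y ((2 : ℝ) • m - t)) / 2 / c) - f θ| := by
  have hint : ∫ t, (B.unnormPost y t + B.unnormPost y ((2 : ℝ) • m - t)) / 2 / c
      = (∫ t, B.unnormPost y t) / c := by
    rw [integral_div, integral_div, integral_add hF (hF.comp_sub_left _),
      integral_sub_left_eq_self]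
    ring
  rw [hint, tvDist, div_eq_mul_inv, mul_comm, ← lintegral_const_mul' _ _ (by simp)]
  refine lintegral_mono fun θ => ?_
  -- Both terms carry the skewness factor and a factor `2`, which cancels the `1/2` in `tvDist`.
  have h1 : B.post y θ - B.skewPerturb y m f θ = 2 * (B.skewFactor y m θ *
      ((B.unnormPost y θ + B.unnormPost y ((2 : ℝ) • m - θ)) / 2 / c
          / ((∫ t, B.unnormPost y t) / c) - f θ)) := by
    have e : (B.unnormPost y θ + B.unnormPost y ((2 : ℝ) • m - θ)) / 2 / c
          / ((∫ t, B.unnormPost y t) / c)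
        = (B.unnormPost y θ + B.unnormPost y ((2 : ℝ) • m - θ)) / 2 / ∫ t, B.unnormPost y t := by
      rw [div_div_div_cancel_right₀ hc.ne']
    rw [e, post, skewPerturb]
    conv_lhs => rw [B.unnormPost_eq_mul_skewFactor y m θ]
    ring
  have h2 : (2 : ENNReal)⁻¹ = ENNReal.ofReal (2⁻¹) := by
    rw [ENNReal.ofReal_inv_of_pos (by norm_num)]; simp
  beta_reduce
  rw [h1, h2, ← ENNReal.ofReal_mul (by norm_num), abs_mul, abs_mul,
    abs_of_nonneg (B.skewFactor_nonneg y m θ)]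
  refine ENNReal.ofReal_le_ofReal ?_
  have := mul_le_of_le_one_left (abs_nonneg
    ((B.unnormPost y θ + B.unnormPost y ((2 : ℝ) • m - θ)) / 2 / c
          / ((∫ t, B.unnormPost y t) / c) - f θ)) (B.skewFactor_le_one y m θ)
  rw [abs_of_pos (by norm_num : (0 : ℝ) < 2)]
  linarith

/-- Crude bound for the regime in which the rate is not small: the perturbation has mass at most
`2`. -/
theorem tvDist_post_skewPerturb_le_two {y : Y} (m : Par d) {f : Par d → ℝ} (hf0 : ∀ θ, 0 ≤ f θ)
    (hf1 : ∫⁻ θ, ENNReal.ofReal (f θ) ≤ 1) :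
    tvDist (B.post y) (B.skewPerturb y m f) ≤ 2 := by
  have hm : Measurable (B.post y) := (B.measurable_unnormPost y).div_const _
  have h1 : ∫⁻ θ, ENNReal.ofReal (B.post y θ) ≤ 1 :=
    lintegral_ofReal_div_integral_le_one (B.unnormPost_nonneg y)
  have hp : ∀ θ, 0 ≤ B.post y θ := fun θ =>
    div_nonneg (B.unnormPost_nonneg y θ) (integral_nonneg (B.unnormPost_nonneg y))
  have h2 : ∫⁻ θ, ENNReal.ofReal |B.post y θ - B.skewPerturb y m f θ|
      ≤ ∫⁻ θ, (ENNReal.ofReal (B.post y θ) + 2 * ENNReal.ofReal (f θ)) := by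
    refine lintegral_mono fun θ => ?_
    rw [show (2 : ENNReal) = ENNReal.ofReal 2 by simp, ← ENNReal.ofReal_mul (by norm_num),
      ← ENNReal.ofReal_add (hp θ) (by linarith [hf0 θ])]
    refine ENNReal.ofReal_le_ofReal ?_
    have h3 : B.skewPerturb y m f θ ≤ 2 * f θ :=
      mul_le_of_le_one_right (by linarith [hf0 θ]) (B.skewFactor_le_one y m θ)
    have h4 : 0 ≤ B.skewPerturb y m f θ :=
      mul_nonneg (by linarith [hf0 θ]) (B.skewFactor_nonneg y m θ)
    rw [abs_le]
    constructor <;> linarith [hp θ, hf0 θ]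
  rw [lintegral_add_left hm.ennreal_ofReal, lintegral_const_mul' _ _ (by simp)] at h2
  rw [tvDist]
  refine ENNReal.div_le_of_le_mul (h2.trans ?_)
  calc _ ≤ (1 : ENNReal) + 2 * 1 := by gcongr
    _ ≤ 2 * 2 := by norm_num

/-- Here `g` is the Gaussian kernel, `b` that kernel times the polynomial, and `c` the unnormalised
posterior at the mode. The factor `4` is a `2` from normalisation times a `2` from `∫ b ≥ ∫ g / 2`.
-/
theorem tvDist_post_skewPerturb_le_of_local {y : Y} {m : Par d} {f g b : Par d → ℝ}
    {c R ε τ : ℝ} (hc : 0 < c) (hF : Integrable (B.unnormPost y)) (hg : Integrable g)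
    (hg0 : ∀ θ, 0 ≤ g θ) (hgpos : 0 < ∫ θ, g θ) (hb : Integrable b) (hgb : ∀ θ, g θ / 2 ≤ b θ)
    (hf : ∀ θ, f θ = b θ / ∫ t, b t) (hε : 0 ≤ ε)
    (hlocal : ∀ θ ∈ Metric.closedBall m R,
      |(B.unnormPost y θ + B.unnormPost y ((2 : ℝ) • m - θ)) / 2 / c - b θ| ≤ ε * g θ)
    (htail : ∫ θ in (Metric.closedBall m R)ᶜ, B.unnormPost y θ ≤ c * (τ * ∫ θ, g θ))
    (htail' : ∫ θ in (Metric.closedBall m R)ᶜ, b θ ≤ τ * ∫ θ, g θ) :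
    tvDist (B.post y) (B.skewPerturb y m f) ≤ ENNReal.ofReal (4 * (ε + 2 * τ)) := by
  set S := Metric.closedBall m R with hS
  have hSm : MeasurableSet S := Metric.isClosed_closedBall.measurableSet
  set F := B.unnormPost y with hFdef
  have hF0 : ∀ θ, 0 ≤ F θ := B.unnormPost_nonneg y
  have hF' : Integrable fun θ => F ((2 : ℝ) • m - θ) := hF.comp_sub_left _
  set a : Par d → ℝ := fun θ => (F θ + F ((2 : ℝ) • m - θ)) / 2 / c with ha
  have hai : Integrable a := ((hF.add hF').div_const 2).div_const c
  have ha0 : ∀ θ, 0 ≤ a θ := fun θ =>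
    div_nonneg (div_nonneg (add_nonneg (hF0 _) (hF0 _)) (by norm_num)) hc.le
  have hb0 : ∀ θ, 0 ≤ b θ := fun θ => by linarith [hg0 θ, hgb θ]
  have hbg : (∫ θ, g θ) / 2 ≤ ∫ θ, b θ := by
    rw [← integral_div]; exact integral_mono (hg.div_const 2) hb hgb
  have hBpos : 0 < ∫ θ, b θ := by linarith
  -- The ball is invariant under reflection in `m`, so symmetrising does not change the posterior
  -- mass outside it.
  have hsymm : ∫ θ in Sᶜ, F ((2 : ℝ) • m - θ) = ∫ θ in Sᶜ, F θ := by
    rw [← integral_indicator hSm.compl, ← integral_indicator hSm.compl,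
      ← integral_sub_left_eq_self _ volume ((2 : ℝ) • m)]
    refine integral_congr_ae (Eventually.of_forall fun θ => ?_)
    have hmem : (2 : ℝ) • m - θ ∈ Sᶜ ↔ θ ∈ Sᶜ := by
      simp only [hS, mem_compl_iff, Metric.mem_closedBall, dist_eq_norm]
      rw [show (2 : ℝ) • m - θ - m = -(θ - m) by rw [two_smul]; abel, norm_neg]
    by_cases h : θ ∈ Sᶜ
    · simp only [indicator_of_mem h, indicator_of_mem (hmem.2 h)]
      congr 1; abel
    · simp only [indicator_of_notMem h, indicator_of_notMem (mt hmem.1 h)]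
  have htaila : ∫ θ in Sᶜ, a θ ≤ τ * ∫ θ, g θ := by
    have : ∫ θ in Sᶜ, a θ = (∫ θ in Sᶜ, F θ) / c := by
      simp only [ha]
      rw [integral_div, integral_div, integral_add hF.integrableOn hF'.integrableOn, hsymm]
      ring
    rw [this, div_le_iff₀ hc]
    linarith
  have hin : ∫ θ in S, |a θ - b θ| ≤ ε * ∫ θ, g θ := by
    calc ∫ θ in S, |a θ - b θ| ≤ ∫ θ in S, ε * g θ :=
          setIntegral_mono_on (hai.sub hb).abs.integrableOn (hg.const_mul ε).integrableOn hSm hlocal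
      _ ≤ ∫ θ, ε * g θ := setIntegral_le_integral (hg.const_mul ε)
          (Eventually.of_forall fun θ => mul_nonneg hε (hg0 θ))
      _ = ε * ∫ θ, g θ := integral_const_mul _ _
  have hout : ∫ θ in Sᶜ, |a θ - b θ| ≤ 2 * τ * ∫ θ, g θ := by
    calc ∫ θ in Sᶜ, |a θ - b θ| ≤ ∫ θ in Sᶜ, (a θ + b θ) := by
          refine setIntegral_mono (hai.sub hb).abs.integrableOn (hai.add hb).integrableOn fun θ => ?_
          exact abs_le.2 ⟨by linarith [ha0 θ, hb0 θ], by linarith [ha0 θ, hb0 θ]⟩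
      _ = (∫ θ in Sᶜ, a θ) + ∫ θ in Sᶜ, b θ := integral_add hai.integrableOn hb.integrableOn
      _ ≤ 2 * τ * ∫ θ, g θ := by linarith
  have htot : ∫ θ, |a θ - b θ| ≤ (ε + 2 * τ) * ∫ θ, g θ := by
    have habs : Integrable fun θ => |a θ - b θ| := (hai.sub hb).abs
    rw [← integral_add_compl hSm habs]
    linarith
  refine (B.tvDist_post_skewPerturb_le m f hc hF).trans ?_
  simp only [hf]
  have hd : Integrable fun θ => |a θ / (∫ t, a t) - b θ / ∫ t, b t| :=
    ((hai.div_const _).sub (hb.div_const _)).abs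
  refine (ofReal_integral_eq_lintegral_ofReal hd
    (Eventually.of_forall fun _ => abs_nonneg _)).symm.le.trans ?_
  refine ENNReal.ofReal_le_ofReal ((integral_abs_div_integral_sub_le hai hb ha0 hBpos).trans ?_)
  rw [div_le_iff₀ hBpos]
  have h0 : 0 ≤ (ε + 2 * τ) := by
    by_contra hneg
    have : (ε + 2 * τ) * ∫ θ, g θ < 0 := mul_neg_of_neg_of_pos (not_le.1 hneg) hgpos
    have h1 : 0 ≤ ∫ θ, |a θ - b θ| := integral_nonneg fun _ => abs_nonneg _
    linarith
  nlinarith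

end BayesModel

/-! ### Expansion of the log-posterior around the mode. -/

namespace BayesModel

variable {d : ℕ} {Y : Type*} [MeasurableSpace Y] (B : BayesModel d Y)

theorem iteratedFDeriv_two_eq_sum (f : Par d → ℝ) (m v : Par d) :
    (iteratedFDeriv ℝ 2 f m fun _ => v) = ∑ i, ∑ j, v i * (v j *
      iteratedFDeriv ℝ 2 f m ![EuclideanSpace.single i 1, EuclideanSpace.single j 1]) := by
  have hv : v = ∑ i, v i • EuclideanSpace.single i (1 : ℝ) := by
    ext k
    simp [Pi.single_apply]
  simp only [iteratedFDeriv_two_apply, Matrix.cons_val_zero, Matrix.cons_val_one]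
  conv_lhs => rw [hv]
  simp only [map_sum, map_smul, sum_apply, smul_apply,
    smul_eq_mul, Finset.mul_sum]
  rw [Finset.sum_comm]
  exact Finset.sum_congr rfl fun i _ => Finset.sum_congr rfl fun j _ => by ring

theorem quadForm_negHess (y : Y) (m v : Par d) :
    quadForm (B.negHess y m) v
      = -((iteratedFDeriv ℝ 2 (B.logLik y) m fun _ => v)
        + iteratedFDeriv ℝ 2 B.logPrior m fun _ => v) := by
  rw [iteratedFDeriv_two_eq_sum, iteratedFDeriv_two_eq_sum]
  simp only [quadForm, negHess, dotProduct, Matrix.mulVec, Finset.mul_sum, ← Finset.sum_add_distrib,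
    ← Finset.sum_neg_distrib]
  exact Finset.sum_congr rfl fun i _ => Finset.sum_congr rfl fun j _ => by ring

/-- Regularity of the log-likelihood (`C^j`) and the log-prior (`C^k`) on the ball of radius `ρ`
around `m`, with the bounds on the higher derivatives. -/
def LocallyRegular (y : Y) (m : Par d) (ρ : ℝ) (n : ℕ) (L : ℝ) (j k : ℕ) : Prop :=
  ∀ θ ∈ Metric.ball m ρ, θ ∈ B.Θ ∧
    (0 < B.lik θ y ∧ ContDiffAt ℝ j (B.logLik y) θ ∧
      ∀ i, 3 ≤ i → i ≤ j → ‖iteratedFDeriv ℝ i (B.logLik y) θ‖ ≤ n * L) ∧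
    (0 < B.prior θ ∧ ContDiffAt ℝ k B.logPrior θ ∧
      ∀ i, 2 ≤ i → i ≤ k → ‖iteratedFDeriv ℝ i B.logPrior θ‖ ≤ L)

variable {B} {y : Y} {m : Par d} {ρ L : ℝ} {n j k : ℕ}

theorem line_mem_ball {v : Par d} (hv : ‖v‖ < ρ) {t : ℝ} (ht : t ∈ Icc (0 : ℝ) 1) :
    m + t • v ∈ Metric.ball m ρ := by
  rw [Metric.mem_ball, dist_eq_norm, add_sub_cancel_left, norm_smul, Real.norm_of_nonneg ht.1]
  nlinarith [norm_nonneg v, ht.2]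

theorem add_mem_ball {v : Par d} (hv : ‖v‖ < ρ) : m + v ∈ Metric.ball m ρ := by
  simpa using line_mem_ball (m := m) hv (t := 1) (by simp)

theorem LocallyRegular.mono {j' k' : ℕ} (h : B.LocallyRegular y m ρ n L j k) (hj : j' ≤ j)
    (hk : k' ≤ k) : B.LocallyRegular y m ρ n L j' k' := fun θ hθ => by
  obtain ⟨h0, ⟨h1, h2, h3⟩, h4, h5, h6⟩ := h θ hθ
  exact ⟨h0, ⟨h1, h2.of_le (by exact_mod_cast hj), fun i hi hi' => h3 i hi (hi'.trans hj)⟩,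
    h4, h5.of_le (by exact_mod_cast hk), fun i hi hi' => h6 i hi (hi'.trans hk)⟩

theorem LocallyRegular.unnormPost_eq (h : B.LocallyRegular y m ρ n L j k) {θ : Par d}
    (hθ : θ ∈ Metric.ball m ρ) :
    B.unnormPost y θ = Real.exp (B.logLik y θ + B.logPrior θ) := by
  obtain ⟨h0, ⟨h1, -, -⟩, h4, -, -⟩ := h θ hθ
  rw [B.unnormPost_of_mem h0, logLik, logPrior, Real.exp_add, Real.exp_log h1, Real.exp_log h4,
    mul_comm]

theorem IsMAP.unnormPost_le (h : B.IsMAP y m) (θ : Par d) :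
    B.unnormPost y θ ≤ B.unnormPost y m := by
  by_cases hθ : θ ∈ B.Θ
  · rw [B.unnormPost_of_mem hθ, B.unnormPost_of_mem h.1]; exact h.2 θ hθ
  · rw [unnormPost, indicator_of_notMem hθ]; exact B.unnormPost_nonneg y m

/-- First-order condition at an interior maximiser. -/
theorem IsMAP.gradient_eq_zero (hmap : B.IsMAP y m) (hρ : 0 < ρ) (hj : 1 ≤ j) (hk : 1 ≤ k)
    (h : B.LocallyRegular y m ρ n L j k) (v : Par d) :
    (iteratedFDeriv ℝ 1 (B.logLik y) m fun _ => v)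
      + (iteratedFDeriv ℝ 1 B.logPrior m fun _ => v) = 0 := by
  obtain ⟨-, ⟨-, h2, -⟩, -, h5, -⟩ := h m (Metric.mem_ball_self hρ)
  have d1 := hasDerivAt_iteratedFDeriv_line (f := B.logLik y) (m := m) (v := v) (t := 0) (k := 0)
    (by rw [zero_smul, add_zero]; exact h2.of_le (by exact_mod_cast hj))
  have d2 := hasDerivAt_iteratedFDeriv_line (f := B.logPrior) (m := m) (v := v) (t := 0) (k := 0)
    (by rw [zero_smul, add_zero]; exact h5.of_le (by exact_mod_cast hk))
  have d3 := d1.add d2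
  simp only [zero_smul, add_zero, iteratedFDeriv_zero_apply] at d3
  refine IsLocalMax.hasDerivAt_eq_zero ?_ d3
  have hcont : Tendsto (fun s : ℝ => m + s • v) (𝓝 0) (𝓝 m) := by
    have : Continuous fun s : ℝ => m + s • v := by fun_prop
    simpa using this.tendsto 0
  filter_upwards [hcont (Metric.ball_mem_nhds m hρ)] with s hs
  have h6 := hmap.unnormPost_le (m + s • v)
  rw [h.unnormPost_eq hs, h.unnormPost_eq (Metric.mem_ball_self hρ), Real.exp_le_exp] at h6
  simpa using h6

theorem LocallyRegular.abs_likTensor_le (h : B.LocallyRegular y m ρ n L j k) (hρ : 0 < ρ) {i : ℕ}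
    (hi : 3 ≤ i) (hij : i ≤ j) (v : Par d) :
    |B.likTensor y m i v| ≤ n * L * ‖v‖ ^ i :=
  (abs_iteratedFDeriv_const_le _ _ _ _).trans (mul_le_mul_of_nonneg_right
    ((h m (Metric.mem_ball_self hρ)).2.1.2.2 i hi hij) (by positivity))

theorem LocallyRegular.abs_prior_tensor_le (h : B.LocallyRegular y m ρ n L j k) (hρ : 0 < ρ)
    {i : ℕ} (hi : 2 ≤ i) (hik : i ≤ k) (v : Par d) :
    |iteratedFDeriv ℝ i B.logPrior m fun _ => v| ≤ L * ‖v‖ ^ i :=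
  (abs_iteratedFDeriv_const_le _ _ _ _).trans (mul_le_mul_of_nonneg_right
    ((h m (Metric.mem_ball_self hρ)).2.2.2.2 i hi hik) (by positivity))

/-- The log-posterior increment, with its quadratic part removed. -/
noncomputable def postRemainder (B : BayesModel d Y) (y : Y) (m v : Par d) : ℝ :=
  B.logLik y (m + v) + B.logPrior (m + v) - (B.logLik y m + B.logPrior m)
    + 1 / 2 * quadForm (B.negHess y m) v

theorem LocallyRegular.unnormPost_add (h : B.LocallyRegular y m ρ n L j k) (hρ : 0 < ρ)
    {v : Par d} (hv : ‖v‖ < ρ) :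
    B.unnormPost y (m + v) / B.unnormPost y m
      = Real.exp (-(1 / 2) * quadForm (B.negHess y m) v) * Real.exp (B.postRemainder y m v) := by
  rw [h.unnormPost_eq (add_mem_ball hv), h.unnormPost_eq (Metric.mem_ball_self hρ), ← Real.exp_sub,
    ← Real.exp_add, postRemainder]
  congr 1; ring

/-- First-order terms vanish at the mode and the quadratic likelihood term is absorbed by the
Hessian. The prior is expanded only to first order: its Taylor remainder and its share of the
Hessian each cost `L‖v‖²/2`. -/
theorem IsMAP.abs_postRemainder_sub_le_four (hmap : B.IsMAP y m) (hρ : 0 < ρ)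
    (h : B.LocallyRegular y m ρ n L 4 2) {v : Par d} (hv : ‖v‖ < ρ) :
    |B.postRemainder y m v - 1 / 6 * B.likTensor y m 3 v| ≤ n * L * ‖v‖ ^ 4 + L * ‖v‖ ^ 2 := by
  have t1 := abs_sub_taylor_line_le (f := B.logLik y) (m := m) (v := v) (B := n * L) 4
    (fun t ht => (h _ (line_mem_ball hv ht)).2.1.2.1)
    (fun t ht => (h _ (line_mem_ball hv ht)).2.1.2.2 4 (by norm_num) le_rfl)
  have t2 := abs_sub_taylor_line_le (f := B.logPrior) (m := m) (v := v) (B := L) 2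
    (fun t ht => (h _ (line_mem_ball hv ht)).2.2.2.1)
    (fun t ht => (h _ (line_mem_ball hv ht)).2.2.2.2 2 le_rfl le_rfl)
  have t3 := h.abs_prior_tensor_le hρ (i := 2) le_rfl le_rfl v
  have g := hmap.gradient_eq_zero hρ (by norm_num) (by norm_num) h v
  have l0 : 0 ≤ n * L * ‖v‖ ^ 4 := (abs_nonneg _).trans (h.abs_likTensor_le hρ (i := 4) (by norm_num) le_rfl v)
  rw [postRemainder, quadForm_negHess, likTensor]
  simp only [Finset.sum_range_succ, Finset.sum_range_zero, iteratedFDeriv_zero_apply] at t1 t2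
  norm_num [Nat.factorial] at t1 t2
  simp only [iteratedFDeriv_one_apply] at g
  rw [abs_le] at t1 t2 t3 ⊢
  constructor <;> linarith

/-- With four prior derivatives the quadratic prior term cancels exactly against the Hessian, and
the cubic one joins the odd quintic likelihood term. -/
theorem IsMAP.abs_postRemainder_sub_le_six (hmap : B.IsMAP y m) (hρ : 0 < ρ)
    (h : B.LocallyRegular y m ρ n L 6 4) {v : Par d} (hv : ‖v‖ < ρ) :
    |B.postRemainder y m v - (1 / 6 * B.likTensor y m 3 v + 1 / 24 * B.likTensor y m 4 v
        + (1 / 120 * B.likTensor y m 5 v + 1 / 6 * iteratedFDeriv ℝ 3 B.logPrior m fun _ => v))|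
      ≤ n * L * ‖v‖ ^ 6 + L * ‖v‖ ^ 4 := by
  have t1 := abs_sub_taylor_line_le (f := B.logLik y) (m := m) (v := v) (B := n * L) 6
    (fun t ht => (h _ (line_mem_ball hv ht)).2.1.2.1)
    (fun t ht => (h _ (line_mem_ball hv ht)).2.1.2.2 6 (by norm_num) le_rfl)
  have t2 := abs_sub_taylor_line_le (f := B.logPrior) (m := m) (v := v) (B := L) 4
    (fun t ht => (h _ (line_mem_ball hv ht)).2.2.2.1)
    (fun t ht => (h _ (line_mem_ball hv ht)).2.2.2.2 4 (by norm_num) le_rfl)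
  have g := hmap.gradient_eq_zero hρ (by norm_num) (by norm_num) h v
  have l0 : 0 ≤ n * L * ‖v‖ ^ 6 := (abs_nonneg _).trans (h.abs_likTensor_le hρ (i := 6) (by norm_num) le_rfl v)
  have l1 : 0 ≤ L * ‖v‖ ^ 4 := (abs_nonneg _).trans (h.abs_prior_tensor_le hρ (i := 4) (by norm_num) le_rfl v)
  simp only [postRemainder, quadForm_negHess, likTensor]
  simp only [Finset.sum_range_succ, Finset.sum_range_zero, iteratedFDeriv_zero_apply] at t1 t2
  norm_num [Nat.factorial] at t1 t2
  simp only [iteratedFDeriv_one_apply] at g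
  rw [abs_le] at t1 t2 ⊢
  constructor <;> linarith

theorem likTensor_neg (i : ℕ) (v : Par d) :
    B.likTensor y m i (-v) = (-1) ^ i * B.likTensor y m i v := iteratedFDeriv_const_neg _ _ _ _

section LocalExpansion

variable {R K : ℝ}

theorem LocallyRegular.symm_unnormPost (h : B.LocallyRegular y m ρ n L j k) (hρ : 0 < ρ)
    {v : Par d} (hv : ‖v‖ < ρ) :
    (B.unnormPost y (m + v) + B.unnormPost y (m - v)) / 2 / B.unnormPost y m
      = Real.exp (-(1 / 2) * quadForm (B.negHess y m) v)
        * ((Real.exp (B.postRemainder y m v) + Real.exp (B.postRemainder y m (-v))) / 2) := by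
  have h1 := h.unnormPost_add hρ hv
  have h2 := h.unnormPost_add hρ (v := -v) (by rwa [norm_neg])
  rw [quadForm_neg, ← sub_eq_add_neg] at h2
  rw [div_right_comm, add_div, h1, h2]
  ring

/-- Everything is measured in powers of `t = n R³`: one has `t ^ k = n R^(k+2) · (n R²)^(k-1)`, and
the last factor is at least `1`. The bound `R ≤ t` serves the prior terms, which carry no factor
`n`. -/
theorem scale_bounds (hn : 1 ≤ n) (hR : 0 ≤ R) (hnR : 1 ≤ n * R ^ 2) :
    R ≤ n * R ^ 3 ∧ n * R ^ 4 ≤ (n * R ^ 3) ^ 2 ∧ n * R ^ 5 ≤ (n * R ^ 3) ^ 3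
      ∧ n * R ^ 6 ≤ (n * R ^ 3) ^ 4 := by
  have hn0 : (0 : ℝ) ≤ n := by positivity
  refine ⟨?_, ?_, ?_, ?_⟩
  · calc R = 1 * R := by ring
      _ ≤ n * R ^ 2 * R := by gcongr
      _ = _ := by ring
  · calc n * R ^ 4 = n * R ^ 4 * 1 := by ring
      _ ≤ n * R ^ 4 * (n * R ^ 2) := by gcongr
      _ = _ := by ring
  · calc n * R ^ 5 = n * R ^ 5 * 1 ^ 2 := by ring
      _ ≤ n * R ^ 5 * (n * R ^ 2) ^ 2 := by gcongr
      _ = _ := by ring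
  · calc n * R ^ 6 = n * R ^ 6 * 1 ^ 3 := by ring
      _ ≤ n * R ^ 6 * (n * R ^ 2) ^ 3 := by gcongr
      _ = _ := by ring

theorem IsMAP.local_expansion_two (hmap : B.IsMAP y m) (hρ : 0 < ρ)
    (h : B.LocallyRegular y m ρ n L 4 2) (hn : 1 ≤ n) (hL : 0 < L) (hR : 0 ≤ R) (hRρ : R < ρ)
    (hnR : 1 ≤ n * R ^ 2) (hK : 1 ≤ K) (hKL : 2 * L ≤ K) (hsmall : K * (n * R ^ 3) ≤ 1 / 4)
    {v : Par d} (hv : ‖v‖ ≤ R) :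
    |(B.unnormPost y (m + v) + B.unnormPost y (m - v)) / 2 / B.unnormPost y m
        - Real.exp (-(1 / 2) * quadForm (B.negHess y m) v)|
      ≤ 6 * (K * (n * R ^ 3)) ^ 2 * Real.exp (-(1 / 2) * quadForm (B.negHess y m) v) := by
  obtain ⟨s1, s2, -, -⟩ := scale_bounds hn hR hnR
  have hv' : ‖v‖ < ρ := hv.trans_lt hRρ
  set t : ℝ := n * R ^ 3 with ht
  have ht0 : 0 ≤ t := by positivity
  have x1 := hmap.abs_postRemainder_sub_le_four hρ h hv'
  have x2 := hmap.abs_postRemainder_sub_le_four hρ h (v := -v) (by rwa [norm_neg])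
  have x3 := h.abs_likTensor_le hρ (i := 3) le_rfl (by norm_num) v
  rw [likTensor_neg, norm_neg] at x2
  -- Since `K ≥ 1`, a factor `2L ≤ K` is absorbed by any power of `K`, so `τ = K t` controls every
  -- order at once.
  have hKK : K ≤ K ^ 2 := by nlinarith
  have err : n * L * ‖v‖ ^ 4 + L * ‖v‖ ^ 2 ≤ (K * t) ^ 2 := by
    calc n * L * ‖v‖ ^ 4 + L * ‖v‖ ^ 2 ≤ n * L * R ^ 4 + L * R ^ 2 := by gcongr
      _ = L * (n * R ^ 4) + L * R ^ 2 := by ring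
      _ ≤ L * t ^ 2 + L * t ^ 2 := by gcongr
      _ = 2 * L * t ^ 2 := by ring
      _ ≤ K ^ 2 * t ^ 2 := by gcongr; linarith
      _ = _ := by ring
  have hb : n * L * ‖v‖ ^ 3 ≤ K * t := by
    calc n * L * ‖v‖ ^ 3 ≤ n * L * R ^ 3 := by gcongr
      _ = L * t := by rw [ht]; ring
      _ ≤ K * t := by gcongr; linarith
  have key := abs_symm_exp_sub_one_le (τ := K * t) (b := 1 / 6 * B.likTensor y m 3 v)
    (x := B.postRemainder y m v) (y := B.postRemainder y m (-v)) hsmall (by positivity)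
    (by rw [abs_mul]; norm_num; linarith [abs_nonneg (B.likTensor y m 3 v)]) (x1.trans err)
    (by
      have := x2.trans err
      rwa [show B.postRemainder y m (-v) - 1 / 6 * ((-1) ^ 3 * B.likTensor y m 3 v)
        = B.postRemainder y m (-v) + 1 / 6 * B.likTensor y m 3 v by ring] at this)
  rw [h.symm_unnormPost hρ hv', ← mul_sub_one, abs_mul, abs_of_pos (Real.exp_pos _), mul_comm]
  gcongr

theorem IsMAP.local_expansion_four (hmap : B.IsMAP y m) (hρ : 0 < ρ)
    (h : B.LocallyRegular y m ρ n L 6 4) (hn : 1 ≤ n) (hL : 0 < L) (hR : 0 ≤ R) (hRρ : R < ρ)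
    (hnR : 1 ≤ n * R ^ 2) (hK : 1 ≤ K) (hKL : 2 * L ≤ K) (hsmall : K * (n * R ^ 3) ≤ 1 / 4)
    {v : Par d} (hv : ‖v‖ ≤ R) :
    |(B.unnormPost y (m + v) + B.unnormPost y (m - v)) / 2 / B.unnormPost y m
        - Real.exp (-(1 / 2) * quadForm (B.negHess y m) v) * B.snpPoly y m v|
      ≤ 100 * (K * (n * R ^ 3)) ^ 4 * Real.exp (-(1 / 2) * quadForm (B.negHess y m) v) := by
  obtain ⟨s1, s2, s3, s4⟩ := scale_bounds hn hR hnR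
  have hv' : ‖v‖ < ρ := hv.trans_lt hRρ
  set t : ℝ := n * R ^ 3 with ht
  have ht0 : 0 ≤ t := by positivity
  have x1 := hmap.abs_postRemainder_sub_le_six hρ h hv'
  have x2 := hmap.abs_postRemainder_sub_le_six hρ h (v := -v) (by rwa [norm_neg])
  have x3 := h.abs_likTensor_le hρ (i := 3) le_rfl (by norm_num) v
  have x4 := h.abs_likTensor_le hρ (i := 4) (by norm_num) (by norm_num) v
  have x5 := h.abs_likTensor_le hρ (i := 5) (by norm_num) (by norm_num) v
  have x6 := h.abs_prior_tensor_le hρ (i := 3) (by norm_num) (by norm_num) v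
  simp only [likTensor_neg, iteratedFDeriv_const_neg, norm_neg] at x2
  have hK2 : K ≤ K ^ 2 := le_self_pow₀ hK (by norm_num)
  have hK3 : K ≤ K ^ 3 := le_self_pow₀ hK (by norm_num)
  have hK4 : K ≤ K ^ 4 := le_self_pow₀ hK (by norm_num)
  have err : n * L * ‖v‖ ^ 6 + L * ‖v‖ ^ 4 ≤ (K * t) ^ 4 := by
    calc n * L * ‖v‖ ^ 6 + L * ‖v‖ ^ 4 ≤ n * L * R ^ 6 + L * R ^ 4 := by gcongr
      _ = L * (n * R ^ 6) + L * R ^ 4 := by ring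
      _ ≤ L * t ^ 4 + L * t ^ 4 := by gcongr
      _ = 2 * L * t ^ 4 := by ring
      _ ≤ K ^ 4 * t ^ 4 := by gcongr; linarith
      _ = _ := by ring
  have hc : n * L * ‖v‖ ^ 5 + L * ‖v‖ ^ 3 ≤ (K * t) ^ 3 := by
    calc n * L * ‖v‖ ^ 5 + L * ‖v‖ ^ 3 ≤ n * L * R ^ 5 + L * R ^ 3 := by gcongr
      _ = L * (n * R ^ 5) + L * R ^ 3 := by ring
      _ ≤ L * t ^ 3 + L * t ^ 3 := by gcongr
      _ = 2 * L * t ^ 3 := by ring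
      _ ≤ K ^ 3 * t ^ 3 := by gcongr; linarith
      _ = _ := by ring
  have ha : n * L * ‖v‖ ^ 4 ≤ (K * t) ^ 2 := by
    calc n * L * ‖v‖ ^ 4 ≤ n * L * R ^ 4 := by gcongr
      _ = L * (n * R ^ 4) := by ring
      _ ≤ L * t ^ 2 := by gcongr
      _ ≤ K ^ 2 * t ^ 2 := by gcongr; linarith
      _ = _ := by ring
  have hb : n * L * ‖v‖ ^ 3 ≤ K * t := by
    calc n * L * ‖v‖ ^ 3 ≤ n * L * R ^ 3 := by gcongr
      _ = L * t := by rw [ht]; ring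
      _ ≤ K * t := by gcongr; linarith
  rw [abs_le] at x3 x4 x5 x6
  have key := abs_symm_exp_sub_poly_le (τ := K * t) (b := 1 / 6 * B.likTensor y m 3 v)
    (a := 1 / 24 * B.likTensor y m 4 v)
    (c := 1 / 120 * B.likTensor y m 5 v + 1 / 6 * iteratedFDeriv ℝ 3 B.logPrior m fun _ => v)
    (x := B.postRemainder y m v) (y := B.postRemainder y m (-v)) hsmall (by positivity)
    (abs_le.2 ⟨by linarith, by linarith⟩) (abs_le.2 ⟨by linarith, by linarith⟩)
    (abs_le.2 ⟨by linarith, by linarith⟩) (x1.trans err)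
    (by
      refine le_trans (le_of_eq ?_) (x2.trans err)
      congr 1
      ring)
  rw [h.symm_unnormPost hρ hv', ← mul_sub, abs_mul, abs_of_pos (Real.exp_pos _), mul_comm, snpPoly]
  gcongr
  refine le_trans (le_of_eq ?_) key
  congr 1
  ring

end LocalExpansion

end BayesModel

/-! ### Tails of the posterior and of the Gaussian kernel. -/

namespace BayesModel

variable {d : ℕ} {Y : Type*} [MeasurableSpace Y] {B : BayesModel d Y} {y : Y} {m : Par d}

theorem integrable_indicator_prior (B : BayesModel d Y) : Integrable (B.Θ.indicator B.prior) := by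
  rw [integrable_indicator_iff B.measurableSet_Θ]
  refine ⟨B.measurable_prior.aestronglyMeasurable, ?_⟩
  rw [hasFiniteIntegral_iff_ofReal (Eventually.of_forall B.prior_nonneg), B.lintegral_prior]
  exact ENNReal.one_lt_top

theorem integral_indicator_prior (B : BayesModel d Y) : ∫ θ, B.Θ.indicator B.prior θ = 1 := by
  rw [integral_indicator B.measurableSet_Θ, integral_eq_lintegral_of_nonneg_ae
    (Eventually.of_forall B.prior_nonneg) B.measurable_prior.aestronglyMeasurable,
    B.lintegral_prior]
  simp

/-- A likelihood bounded by `Λ` off a ball around the maximiser bounds the posterior tail. -/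
theorem IsMAP.integrable_unnormPost_and_tail_le (hmap : B.IsMAP y m) {R Λ : ℝ} (hΛ : 0 ≤ Λ)
    (h : ∀ θ ∈ B.Θ, R < ‖θ - m‖ → B.lik θ y ≤ Λ) :
    Integrable (B.unnormPost y) ∧ ∫ θ in (Metric.closedBall m R)ᶜ, B.unnormPost y θ ≤ Λ := by
  set S := Metric.closedBall m R
  have hSm : MeasurableSet S := Metric.isClosed_closedBall.measurableSet
  have hp := B.integrable_indicator_prior
  have hout : ∀ θ ∈ Sᶜ, B.unnormPost y θ ≤ Λ * B.Θ.indicator B.prior θ := by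
    intro θ hθ
    by_cases hΘ : θ ∈ B.Θ
    · rw [B.unnormPost_of_mem hΘ, indicator_of_mem hΘ, mul_comm Λ]
      refine mul_le_mul_of_nonneg_left (h θ hΘ ?_) (B.prior_nonneg θ)
      simpa [S, dist_eq_norm] using hθ
    · simp [unnormPost, indicator_of_notMem hΘ]
  have hp0 : ∀ θ, 0 ≤ B.Θ.indicator B.prior θ := fun θ =>
    indicator_nonneg (fun θ _ => B.prior_nonneg θ) θ
  -- Inside the ball the value at the mode dominates, outside it a multiple of the prior; a finite
  -- evidence is thus a consequence.
  have hint : Integrable (B.unnormPost y) := by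
    have h1 : Integrable (S.indicator fun _ => B.unnormPost y m) :=
      (integrable_indicator_iff hSm).2 (integrableOn_const (isCompact_closedBall m R).measure_ne_top)
    refine (h1.add (hp.const_mul Λ)).mono' (B.measurable_unnormPost y).aestronglyMeasurable
      (Eventually.of_forall fun θ => ?_)
    rw [Real.norm_of_nonneg (B.unnormPost_nonneg y θ)]
    have h2 : 0 ≤ Λ * B.Θ.indicator B.prior θ := mul_nonneg hΛ (hp0 θ)
    by_cases hθ : θ ∈ S
    · simp only [Pi.add_apply, indicator_of_mem hθ]
      linarith [hmap.unnormPost_le θ]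
    · simp only [Pi.add_apply, indicator_of_notMem hθ, zero_add]
      exact hout θ hθ
  refine ⟨hint, ?_⟩
  calc ∫ θ in Sᶜ, B.unnormPost y θ ≤ ∫ θ in Sᶜ, Λ * B.Θ.indicator B.prior θ :=
        setIntegral_mono_on hint.integrableOn (hp.const_mul Λ).integrableOn hSm.compl hout
    _ ≤ ∫ θ, Λ * B.Θ.indicator B.prior θ := setIntegral_le_integral (hp.const_mul Λ)
        (Eventually.of_forall fun θ => mul_nonneg hΛ (hp0 θ))
    _ = Λ := by rw [integral_const_mul, B.integral_indicator_prior, mul_one]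

end BayesModel

/-- Tail of a Gaussian kernel times a factor of moderate exponential growth. -/
theorem integrable_gauss_mul_and_tail_le {d : ℕ} {A : Matrix (Fin d) (Fin d) ℝ} {η C R : ℝ}
    (hη : 0 < η) (hC : 0 ≤ C) (hR : 0 ≤ R) (h : ∀ v, η * ‖v‖ ^ 2 ≤ quadForm A v) {P : Par d → ℝ}
    (hP : Continuous P) (hP0 : ∀ v, 0 ≤ P v) (hPC : ∀ v, P v ≤ C * Real.exp (η * ‖v‖ ^ 2 / 8)) :
    Integrable (fun v => Real.exp (-(1 / 2) * quadForm A v) * P v) ∧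
      ∫ v in (Metric.closedBall 0 R)ᶜ, Real.exp (-(1 / 2) * quadForm A v) * P v
        ≤ C * Real.exp (-(η * R ^ 2 / 8)) * Real.sqrt 2 ^ d
          * ∫ v, Real.exp (-(1 / 2) * quadForm A v) := by
  have hq : Integrable fun v : Par d => Real.exp (-(1 / 4) * quadForm A v) :=
    integrable_exp_neg_quadForm hη (by norm_num) h
  have hb : ∀ v, Real.exp (-(1 / 2) * quadForm A v) * P v
      ≤ C * (Real.exp (-(η * ‖v‖ ^ 2 / 8)) * Real.exp (-(1 / 4) * quadForm A v)) := by
    intro v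
    calc Real.exp (-(1 / 2) * quadForm A v) * P v
        ≤ Real.exp (-(1 / 2) * quadForm A v) * (C * Real.exp (η * ‖v‖ ^ 2 / 8)) := by
          gcongr; exact hPC v
      _ = C * Real.exp (-(1 / 2) * quadForm A v + η * ‖v‖ ^ 2 / 8) := by rw [Real.exp_add]; ring
      -- Half of the exponent, `quadForm / 4 ≥ η‖v‖²/4`, is spent: one `η‖v‖²/8` absorbs the growth
      -- of `P`, the other yields the tail factor. The remaining quarter form stays integrable.
      _ ≤ C * Real.exp (-(η * ‖v‖ ^ 2 / 8) + -(1 / 4) * quadForm A v) := by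
          exact mul_le_mul_of_nonneg_left (Real.exp_le_exp.2 (by linarith [h v])) hC
      _ = _ := by rw [Real.exp_add]
  have hnn : ∀ v, 0 ≤ Real.exp (-(1 / 2) * quadForm A v) * P v := fun v =>
    mul_nonneg (Real.exp_pos _).le (hP0 v)
  have hint : Integrable fun v => Real.exp (-(1 / 2) * quadForm A v) * P v := by
    refine (hq.const_mul C).mono' ((Real.continuous_exp.comp
      ((continuous_quadForm A).const_mul _)).mul hP).aestronglyMeasurable
      (Eventually.of_forall fun v => ?_)
    rw [Real.norm_of_nonneg (hnn v)]
    refine (hb v).trans (mul_le_mul_of_nonneg_left (mul_le_of_le_one_left (Real.exp_pos _).le ?_) hC)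
    exact Real.exp_le_one_iff.2 (by have := sq_nonneg ‖v‖; nlinarith)
  refine ⟨hint, ?_⟩
  have hSm : MeasurableSet (Metric.closedBall (0 : Par d) R)ᶜ :=
    Metric.isClosed_closedBall.measurableSet.compl
  have hD := hq.const_mul (C * Real.exp (-(η * R ^ 2 / 8)))
  calc ∫ v in (Metric.closedBall 0 R)ᶜ, Real.exp (-(1 / 2) * quadForm A v) * P v
      ≤ ∫ v in (Metric.closedBall 0 R)ᶜ,
          C * Real.exp (-(η * R ^ 2 / 8)) * Real.exp (-(1 / 4) * quadForm A v) := by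
        refine setIntegral_mono_on hint.integrableOn hD.integrableOn hSm fun v hv => ?_
        refine (hb v).trans ?_
        rw [← mul_assoc]
        have hv' : R ≤ ‖v‖ := by
          have : R < ‖v‖ := by simpa using hv
          exact this.le
        gcongr
    _ ≤ ∫ v, C * Real.exp (-(η * R ^ 2 / 8)) * Real.exp (-(1 / 4) * quadForm A v) :=
        setIntegral_le_integral hD (Eventually.of_forall fun v => by positivity)
    _ = _ := by rw [integral_const_mul, integral_exp_neg_quadForm_quarter]; ring

/-! ### Total variation bound for a fixed sample. -/

namespace BayesModel

variable {d : ℕ} {Y : Type*} [MeasurableSpace Y] {B : BayesModel d Y} {y : Y} {m : Par d}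

theorem IsMAP.tvDist_le (hmap : B.IsMAP y m) {f P : Par d → ℝ} {n : ℕ} (hn : 1 ≤ n)
    {θs : Par d} {r R η₁ η₂ C ε τ π₀ E : ℝ} (hθs : θs ∈ B.Θ) (hlik : 0 < B.lik θs y)
    (hπ₀ : 0 < π₀) (hprior : π₀ ≤ B.prior θs) (hr : ‖m - θs‖ ≤ r) (hR : 0 ≤ R) (hrR : 2 * r ≤ R)
    (hsep : ∀ θ ∈ B.Θ, r < ‖θ - θs‖ → B.lik θ y ≤ B.lik θs y * E) (hE : 0 ≤ E)
    (hη₁ : 0 < η₁) (hη₂ : 0 < η₂)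
    (hJ : ∀ v, n * η₁ * ‖v‖ ^ 2 ≤ quadForm (B.negHess y m) v)
    (hJ' : ∀ v, quadForm (B.negHess y m) v ≤ n * η₂ * ‖v‖ ^ 2)
    (hP : Continuous P) (hP2 : ∀ v, 1 / 2 ≤ P v) (hC : 0 ≤ C)
    (hPC : ∀ v, P v ≤ C * Real.exp (n * η₁ * ‖v‖ ^ 2 / 8)) (hε : 0 ≤ ε)
    (hlocal : ∀ v, ‖v‖ ≤ R →
      |(B.unnormPost y (m + v) + B.unnormPost y (m - v)) / 2 / B.unnormPost y m
        - Real.exp (-(1 / 2) * quadForm (B.negHess y m) v) * P v|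
      ≤ ε * Real.exp (-(1 / 2) * quadForm (B.negHess y m) v))
    (hf : ∀ θ, f θ = Real.exp (-(1 / 2) * quadForm (B.negHess y m) (θ - m)) * P (θ - m)
      / ∫ v, Real.exp (-(1 / 2) * quadForm (B.negHess y m) v) * P v)
    (hτ : 0 ≤ τ)
    (htail : E ≤ π₀ * (τ * (2 * Real.pi / (n * η₂)) ^ ((d : ℝ) / 2)))
    (htail' : C * Real.exp (-(n * η₁ * R ^ 2 / 8)) * Real.sqrt 2 ^ d ≤ τ) :
    tvDist (B.post y) (B.skewPerturb y m f) ≤ ENNReal.ofReal (4 * (ε + 2 * τ)) := by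
  have hn0 : (0 : ℝ) < n := by exact_mod_cast hn
  set g : Par d → ℝ := fun v => Real.exp (-(1 / 2) * quadForm (B.negHess y m) v) with hg
  have hgi : Integrable g := integrable_exp_neg_quadForm (mul_pos hn0 hη₁) (by norm_num) hJ
  have hgl := le_integral_exp_neg_quadForm (mul_pos hn0 hη₁) (mul_pos hn0 hη₂) hJ hJ'
  have hgpos : 0 < ∫ v, g v := lt_of_lt_of_le (by have := Real.pi_pos; positivity) hgl
  obtain ⟨hbi, hbt⟩ := integrable_gauss_mul_and_tail_le (mul_pos hn0 hη₁) hC hR hJ hP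
    (fun v => by linarith [hP2 v]) hPC
  -- As `R ≥ 2r` and the mode is within `r` of `θs`, leaving the `R`-ball of the mode means leaving
  -- the `r`-ball of `θs`.
  have hfar : ∀ θ ∈ B.Θ, R < ‖θ - m‖ → B.lik θ y ≤ B.lik θs y * E := by
    intro θ hθ hθR
    refine hsep θ hθ ?_
    have : ‖θ - m‖ ≤ ‖θ - θs‖ + ‖m - θs‖ := by
      rw [show θ - m = (θ - θs) - (m - θs) by abel]; exact norm_sub_le _ _
    linarith
  obtain ⟨hFi, hFt⟩ := hmap.integrable_unnormPost_and_tail_le (mul_nonneg hlik.le hE) hfar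
  -- Maximality of the mode transfers the prior lower bound at `θs` to the mode, so the likelihood
  -- at `θs` cancels from the relative tail.
  have hFm : π₀ * B.lik θs y ≤ B.unnormPost y m := by
    refine le_trans ?_ (hmap.unnormPost_le θs)
    rw [B.unnormPost_of_mem hθs]
    exact mul_le_mul_of_nonneg_right hprior hlik.le
  have hFpos : 0 < B.unnormPost y m := lt_of_lt_of_le (mul_pos hπ₀ hlik) hFm
  have htrans : ∀ h : Par d → ℝ, ∫ θ, h (θ - m) = ∫ v, h v := fun h =>
    integral_sub_right_eq_self h m
  refine B.tvDist_post_skewPerturb_le_of_local (g := fun θ => g (θ - m))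
    (b := fun θ => g (θ - m) * P (θ - m)) (R := R) hFpos hFi (hgi.comp_sub_right m)
    (fun θ => (Real.exp_pos _).le) (by rwa [htrans]) (hbi.comp_sub_right m) ?_ ?_ hε ?_ ?_ ?_
  · intro θ
    have := mul_le_mul_of_nonneg_left (hP2 (θ - m)) (Real.exp_pos
      (-(1 / 2) * quadForm (B.negHess y m) (θ - m))).le
    simp only [hg]
    linarith
  · intro θ
    rw [htrans fun v => g v * P v]
    exact hf θ
  · intro θ hθ
    have h1 := hlocal (θ - m) (by simpa [dist_eq_norm] using hθ)
    rwa [add_sub_cancel, show m - (θ - m) = (2 : ℝ) • m - θ by rw [two_smul]; abel] at h1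
  · rw [htrans]
    refine hFt.trans ?_
    calc B.lik θs y * E
        ≤ B.lik θs y * (π₀ * (τ * (2 * Real.pi / (n * η₂)) ^ ((d : ℝ) / 2))) := by gcongr
      _ = π₀ * B.lik θs y * (τ * (2 * Real.pi / (n * η₂)) ^ ((d : ℝ) / 2)) := by ring
      _ ≤ B.unnormPost y m * (τ * ∫ v, g v) := by
          have : 0 ≤ (2 * Real.pi / (n * η₂)) ^ ((d : ℝ) / 2) := by
            have := Real.pi_pos; positivity
          gcongr
  · rw [htrans]
    refine le_trans (le_of_eq ?_) (hbt.trans (mul_le_mul_of_nonneg_right htail' hgpos.le))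
    have hSm : MeasurableSet (Metric.closedBall m R)ᶜ :=
      Metric.isClosed_closedBall.measurableSet.compl
    have hSm' : MeasurableSet (Metric.closedBall (0 : Par d) R)ᶜ :=
      Metric.isClosed_closedBall.measurableSet.compl
    rw [← integral_indicator hSm, ← integral_indicator hSm']
    refine Eq.trans ?_ (htrans ((Metric.closedBall (0 : Par d) R)ᶜ.indicator
      fun v => Real.exp (-(1 / 2) * quadForm (B.negHess y m) v) * P v))
    refine integral_congr_ae (Eventually.of_forall fun θ => ?_)
    classical
    simp only [indicator_apply, mem_compl_iff, Metric.mem_closedBall, dist_eq_norm, sub_zero]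
    rfl

/-- With `a` the quartic term, `1 + a + a²/2 = ((1 + a)² + 1)/2`. The square `a²/2`, of the order of
the error, thus keeps the polynomial positive. -/
theorem half_le_snpPoly (v : Par d) : 1 / 2 ≤ B.snpPoly y m v := by
  unfold snpPoly
  nlinarith [sq_nonneg (1 + 1 / 24 * B.likTensor y m 4 v), sq_nonneg (1 / 6 * B.likTensor y m 3 v)]

theorem continuous_snpPoly : Continuous (B.snpPoly y m) := by
  unfold snpPoly likTensor
  have h : ∀ k, Continuous fun v : Par d => iteratedFDeriv ℝ k (B.logLik y) m fun _ => v :=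
    fun k => (iteratedFDeriv ℝ k (B.logLik y) m).cont.comp (by fun_prop)
  have h3 := h 3
  have h4 := h 4
  fun_prop

/-- In `x = n‖v‖²` the polynomial is bounded by powers of `x`, because `n ≥ 1`, and `x ^ k ≤ k!
(8/η) ^ k exp(ηx/8)`. The constant is free of `n` and `d`. -/
theorem snpPoly_le_exp {n : ℕ} (hn : 1 ≤ n) {L η : ℝ} (hL : 0 < L) (hη : 0 < η)
    (h3 : ∀ v, |B.likTensor y m 3 v| ≤ n * L * ‖v‖ ^ 3)
    (h4 : ∀ v, |B.likTensor y m 4 v| ≤ n * L * ‖v‖ ^ 4) (v : Par d) :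
    B.snpPoly y m v ≤ (1 + L * (2 * (8 / η) ^ 2) + L ^ 2 * (24 * (8 / η) ^ 4)
      + L ^ 2 * (6 * (8 / η) ^ 3)) * Real.exp (n * η * ‖v‖ ^ 2 / 8) := by
  have hn1 : (1 : ℝ) ≤ n := by exact_mod_cast hn
  set x : ℝ := n * ‖v‖ ^ 2 with hx
  have hx0 : 0 ≤ x := by positivity
  have hpow : ∀ k : ℕ, x ^ k ≤ (k.factorial : ℝ) * (8 / η) ^ k * Real.exp (n * η * ‖v‖ ^ 2 / 8) := by
    intro k
    have h := Real.pow_div_factorial_le_exp (x := η * x / 8) (by positivity) k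
    rw [div_le_iff₀ (by positivity)] at h
    have e : η * x / 8 = n * η * ‖v‖ ^ 2 / 8 := by rw [hx]; ring
    calc x ^ k = (8 / η) ^ k * (η * x / 8) ^ k := by
          rw [← mul_pow]; congr 1; field_simp
      _ ≤ (8 / η) ^ k * (Real.exp (η * x / 8) * k.factorial) := by gcongr
      _ = _ := by rw [e]; ring
  have p0 := hpow 0
  have p2 := hpow 2
  have p3 := hpow 3
  have p4 := hpow 4
  norm_num [Nat.factorial] at p0 p2 p3 p4
  have a4 : |B.likTensor y m 4 v| ≤ L * x ^ 2 := by
    refine (h4 v).trans ?_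
    rw [hx]
    have : (n : ℝ) ≤ n ^ 2 := by nlinarith
    calc n * L * ‖v‖ ^ 4 ≤ n ^ 2 * L * ‖v‖ ^ 4 := by gcongr
      _ = _ := by ring
  have a3 : B.likTensor y m 3 v ^ 2 ≤ L ^ 2 * x ^ 3 := by
    have : (n : ℝ) ^ 2 ≤ (n : ℝ) ^ 3 := pow_le_pow_right₀ hn1 (by norm_num)
    calc B.likTensor y m 3 v ^ 2 = |B.likTensor y m 3 v| ^ 2 := (sq_abs _).symm
      _ ≤ (n * L * ‖v‖ ^ 3) ^ 2 := by gcongr; exact h3 v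
      _ = n ^ 2 * L ^ 2 * ‖v‖ ^ 6 := by ring
      _ ≤ n ^ 3 * L ^ 2 * ‖v‖ ^ 6 := by gcongr
      _ = _ := by rw [hx]; ring
  have a44 : B.likTensor y m 4 v ^ 2 ≤ L ^ 2 * x ^ 4 := by
    calc B.likTensor y m 4 v ^ 2 = |B.likTensor y m 4 v| ^ 2 := (sq_abs _).symm
      _ ≤ (L * x ^ 2) ^ 2 := by gcongr
      _ = _ := by ring
  have q2 := mul_le_mul_of_nonneg_left p2 hL.le
  have q3 := mul_le_mul_of_nonneg_left p3 (sq_nonneg L)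
  have q4 := mul_le_mul_of_nonneg_left p4 (sq_nonneg L)
  have a4' := (abs_le.1 a4).2
  have n2 : 0 ≤ L * x ^ 2 := by positivity
  have n3 : 0 ≤ L ^ 2 * x ^ 3 := by positivity
  have n4 : 0 ≤ L ^ 2 * x ^ 4 := by positivity
  have e0 : 1 ≤ Real.exp (n * η * ‖v‖ ^ 2 / 8) := Real.one_le_exp (by positivity)
  calc B.snpPoly y m v ≤ 1 + L * x ^ 2 + L ^ 2 * x ^ 4 + L ^ 2 * x ^ 3 := by
        unfold snpPoly; nlinarith
    _ ≤ _ := by linarith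

theorem laplace_eq {y : Y} {m : Par d} (hA : (B.negHess y m).PosDef) (θ : Par d) :
    B.laplace y m θ = Real.exp (-(1 / 2) * quadForm (B.negHess y m) (θ - m))
      / ∫ v, Real.exp (-(1 / 2) * quadForm (B.negHess y m) v) := gaussDensity_inv hA m θ

theorem snp_eq {y : Y} {m : Par d} (hA : (B.negHess y m).PosDef)
    (hpos : 0 < ∫ v, Real.exp (-(1 / 2) * quadForm (B.negHess y m) v)) (θ : Par d) :
    B.snp y m θ = Real.exp (-(1 / 2) * quadForm (B.negHess y m) (θ - m)) * B.snpPoly y m (θ - m)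
      / ∫ v, Real.exp (-(1 / 2) * quadForm (B.negHess y m) v) * B.snpPoly y m v := by
  have h1 : ∫ t, B.laplace y m t * B.snpPoly y m (t - m)
      = (∫ v, Real.exp (-(1 / 2) * quadForm (B.negHess y m) v) * B.snpPoly y m v)
        / ∫ v, Real.exp (-(1 / 2) * quadForm (B.negHess y m) v) := by
    rw [← integral_div]
    refine Eq.trans ?_ (integral_sub_right_eq_self (fun v : Par d =>
      Real.exp (-(1 / 2) * quadForm (B.negHess y m) v) * B.snpPoly y m v
        / ∫ v, Real.exp (-(1 / 2) * quadForm (B.negHess y m) v)) m)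
    refine integral_congr_ae (Eventually.of_forall fun t => ?_)
    simp only [laplace_eq hA]
    ring
  rw [snp, h1, laplace_eq hA, div_mul_eq_mul_div, div_div_div_cancel_right₀ hpos.ne']

theorem laplace_nonneg (y : Y) (m θ : Par d) : 0 ≤ B.laplace y m θ :=
  mul_nonneg (inv_nonneg.2 (Real.sqrt_nonneg _)) (Real.exp_pos _).le

theorem laplace_mul_snpPoly_nonneg (y : Y) (m θ : Par d) :
    0 ≤ B.laplace y m θ * B.snpPoly y m (θ - m) :=
  mul_nonneg (laplace_nonneg y m θ) (by linarith [half_le_snpPoly (B := B) (y := y) (m := m) (θ - m)])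

theorem tvDist_snp_le_two (y : Y) (m : Par d) :
    tvDist (B.post y) (B.skewPerturb y m (B.snp y m)) ≤ 2 :=
  B.tvDist_post_skewPerturb_le_two m
    (fun θ => div_nonneg (laplace_mul_snpPoly_nonneg y m θ)
      (integral_nonneg (laplace_mul_snpPoly_nonneg y m)))
    (lintegral_ofReal_div_integral_le_one (laplace_mul_snpPoly_nonneg y m))

theorem tvDist_laplace_le_two {y : Y} {m : Par d} (hA : (B.negHess y m).PosDef) :
    tvDist (B.post y) (B.skewPerturb y m (B.laplace y m)) ≤ 2 := by
  refine B.tvDist_post_skewPerturb_le_two m (laplace_nonneg y m) ?_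
  simp only [laplace_eq hA]
  have h := integral_sub_right_eq_self (μ := volume)
    (fun v : Par d => Real.exp (-(1 / 2) * quadForm (B.negHess y m) v)) m
  rw [← h]
  exact lintegral_ofReal_div_integral_le_one fun θ => (Real.exp_pos _).le

end BayesModel

/-! ### Tail terms against `n⁻²`, uniformly in the dimension. -/

section Rates

/-- With `l = log n`, the exponent `c₁ l² d` must beat `C l d + 2l + O(l d)`. The square of `l`
matters: `c₁` is supplied only after the separation sequence is chosen, so a multiple of `l` might
not beat `C l`. -/
theorem eventually_exp_neg_log_sq_le {c₁ η : ℝ} (hc₁ : 0 < c₁) (hη : 0 < η) (C : ℝ) :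
    ∀ᶠ n : ℕ in atTop, ∀ d : ℕ, 1 ≤ d →
      Real.exp (-c₁ * Real.log n ^ 2 * d)
        ≤ (n : ℝ) ^ (-(C * d)) * (((n : ℝ) ^ 2)⁻¹ * (2 * Real.pi / (n * η)) ^ ((d : ℝ) / 2)) := by
  set a := Real.log (2 * Real.pi / η) with ha
  have hl : Tendsto (fun n : ℕ => Real.log n) atTop atTop :=
    Real.tendsto_log_atTop.comp tendsto_natCast_atTop_atTop
  filter_upwards [hl.eventually_ge_atTop 1, hl.eventually_ge_atTop ((|C| + 3 + |a|) / c₁),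
    eventually_ge_atTop 1] with n h1 h2 hn d hd
  have hn0 : (0 : ℝ) < n := by exact_mod_cast hn
  have hpi := Real.pi_pos
  have hd1 : (1 : ℝ) ≤ d := by exact_mod_cast hd
  set l := Real.log n with hldef
  rw [div_le_iff₀ hc₁] at h2
  have e1 : (n : ℝ) ^ (-(C * d)) = Real.exp (l * (-(C * d))) := Real.rpow_def_of_pos hn0 _
  have e2 : ((n : ℝ) ^ 2)⁻¹ = Real.exp (-(2 * l)) := by
    rw [Real.exp_neg, two_mul, Real.exp_add, hldef, Real.exp_log hn0, sq]
  have e3 : (2 * Real.pi / (n * η)) ^ ((d : ℝ) / 2) = Real.exp ((a - l) * (d / 2)) := by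
    rw [Real.rpow_def_of_pos (by positivity)]
    congr 2
    rw [ha, hldef, ← Real.log_div (by positivity) hn0.ne']
    congr 1
    field_simp
  rw [e1, e2, e3, ← Real.exp_add, ← Real.exp_add, Real.exp_le_exp]
  have hC := neg_abs_le a
  have hC' := le_abs_self C
  have k1 : C * l ≤ |C| * l := by gcongr
  have k2 : -a ≤ |a| * l := by nlinarith [abs_nonneg a]
  have k3 : (|C| + 3 + |a|) * l ≤ c₁ * l ^ 2 := by nlinarith
  have k4 : 0 ≤ c₁ * l ^ 2 - C * l - 2 * l - l / 2 + a / 2 := by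
    nlinarith [abs_nonneg a]
  have k5 : 2 * l ≤ 2 * l * d := by nlinarith
  nlinarith [mul_nonneg k4 (by linarith : (0 : ℝ) ≤ d)]

theorem eventually_mul_exp_neg_log_sq_le {C η : ℝ} (hC : 0 < C) (hη : 0 < η) :
    ∀ᶠ n : ℕ in atTop, ∀ d : ℕ, 1 ≤ d →
      C * Real.exp (-(η * Real.log n ^ 2 * d / 2)) * Real.sqrt 2 ^ d ≤ ((n : ℝ) ^ 2)⁻¹ := by
  set b := Real.log C with hb
  have hl : Tendsto (fun n : ℕ => Real.log n) atTop atTop :=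
    Real.tendsto_log_atTop.comp tendsto_natCast_atTop_atTop
  filter_upwards [hl.eventually_ge_atTop 1, hl.eventually_ge_atTop ((2 * |b| + 6) / η),
    eventually_ge_atTop 1] with n h1 h2 hn d hd
  have hn0 : (0 : ℝ) < n := by exact_mod_cast hn
  have hd1 : (1 : ℝ) ≤ d := by exact_mod_cast hd
  set l := Real.log n with hldef
  rw [div_le_iff₀ hη] at h2
  have e1 : C = Real.exp b := (Real.exp_log hC).symm
  have e2 : ((n : ℝ) ^ 2)⁻¹ = Real.exp (-(2 * l)) := by
    rw [Real.exp_neg, two_mul, Real.exp_add, hldef, Real.exp_log hn0, sq]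
  have e3 : Real.sqrt 2 ^ d ≤ Real.exp d := by
    rw [← mul_one (d : ℝ), Real.exp_nat_mul]
    have : Real.sqrt 2 ≤ Real.exp 1 := by
      rw [Real.sqrt_le_left (Real.exp_pos 1).le]
      nlinarith [Real.add_one_le_exp (1 : ℝ)]
    gcongr
  calc C * Real.exp (-(η * l ^ 2 * d / 2)) * Real.sqrt 2 ^ d
      ≤ Real.exp b * Real.exp (-(η * l ^ 2 * d / 2)) * Real.exp d := by
        rw [← e1]; gcongr
    _ = Real.exp (b + -(η * l ^ 2 * d / 2) + d) := by rw [Real.exp_add, Real.exp_add]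
    _ ≤ Real.exp (-(2 * l)) := by
        refine Real.exp_le_exp.2 ?_
        have k1 : b ≤ |b| * l := by nlinarith [le_abs_self b, abs_nonneg b]
        have k2 : (2 * |b| + 6) * l ≤ η * l ^ 2 := by nlinarith
        have k3 : |b| * l ≤ |b| * l * d :=
          le_mul_of_one_le_right (mul_nonneg (abs_nonneg b) (by linarith)) hd1
        have k4 : (2 * |b| + 6) * l * d ≤ η * l ^ 2 * d := by gcongr
        have k5 : (d : ℝ) ≤ l * d := by nlinarith
        have k6 : l ≤ l * d := by nlinarith
        linarith
    _ = _ := e2.symm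

end Rates

/-! ### The good event and the explicit bounds on it. -/

namespace BayesModel

variable {d : ℕ} {Y : Type*} [MeasurableSpace Y]

/-- The (asymptotically sure) event on which the approximations of the posterior are accurate. -/
structure GoodSample (B : BayesModel d Y) (y : Y) (m θs : Par d) (n : ℕ) (r ρ L η₁ η₂ E : ℝ)
    (j k : ℕ) : Prop where
  isMAP : B.IsMAP y m
  near : ‖m - θs‖ ≤ r
  separated : 0 < B.lik θs y → ∀ θ ∈ B.Θ, r < ‖θ - θs‖ → B.lik θ y ≤ B.lik θs y * E
  posDef : (B.negHess y m).PosDef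
  le_quadForm : ∀ v, n * η₁ * ‖v‖ ^ 2 ≤ quadForm (B.negHess y m) v
  quadForm_le : ∀ v, quadForm (B.negHess y m) v ≤ n * η₂ * ‖v‖ ^ 2
  -- Conditional because in high dimension `r` may exceed `ρ`; the rate is then above the threshold
  -- and regularity is not used.
  regular : r < ρ → B.LocallyRegular y m ρ n L j k

section

variable {B : BayesModel d Y} {y : Y} {m θs : Par d} {n : ℕ}
  {r ρ L η₁ η₂ E M K κ π₀ : ℝ}

theorem sq_radius (hn : 1 ≤ n) (hr : r = M * Real.sqrt d / Real.sqrt n) :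
    n * (2 * r) ^ 2 = 4 * M ^ 2 * d := by
  have hn0 : (0 : ℝ) < n := by exact_mod_cast hn
  rw [hr, mul_pow, div_pow, mul_pow, Real.sq_sqrt (Nat.cast_nonneg d), Real.sq_sqrt hn0.le]
  field_simp
  ring

/-- This is where the rate comes from: `τ²` is a multiple of `M⁶ d³ / n`. -/
theorem sq_scale (hn : 1 ≤ n) (hr : r = M * Real.sqrt d / Real.sqrt n) :
    (n * (2 * r) ^ 3) ^ 2 = 64 * (M ^ 6 * d ^ 3 / n) := by
  have hn0 : (0 : ℝ) < n := by exact_mod_cast hn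
  have h := sq_radius hn hr
  have : (n * (2 * r) ^ 3) ^ 2 = (n * (2 * r) ^ 2) ^ 3 / n := by field_simp
  rw [this, h]
  ring

/-- A rate below `κ` places the expansion ball inside the regularity ball and makes `τ ≤ 1/4`, as
the exponential estimates require. -/
theorem scale_le (hn : 1 ≤ n) (hr : r = M * Real.sqrt d / Real.sqrt n) (hρ : 0 < ρ)
    (hK : 1 ≤ K) (hκ : 64 * κ ≤ (min (ρ / 2) (1 / (4 * K))) ^ 2) (hle : M ^ 6 * d ^ 3 / n ≤ κ) :
    n * (2 * r) ^ 3 ≤ ρ / 2 ∧ K * (n * (2 * r) ^ 3) ≤ 1 / 4 := by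
  have h0 : 0 ≤ min (ρ / 2) (1 / (4 * K)) := by positivity
  have h1 : n * (2 * r) ^ 3 ≤ min (ρ / 2) (1 / (4 * K)) := by
    refine le_of_sq_le_sq ?_ h0
    rw [sq_scale hn hr]
    linarith
  refine ⟨h1.trans (min_le_left _ _), ?_⟩
  have h2 := h1.trans (min_le_right _ _)
  rw [le_div_iff₀ (by positivity)] at h2
  linarith

theorem inv_le_rate (hn : 1 ≤ n) (hd : 1 ≤ d) (hM : 1 ≤ M) : (n : ℝ)⁻¹ ≤ M ^ 6 * d ^ 3 / n := by
  have hd1 : (1 : ℝ) ≤ d := by exact_mod_cast hd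
  rw [inv_eq_one_div]
  gcongr
  nlinarith [one_le_pow₀ hM (n := 6), one_le_pow₀ hd1 (n := 3)]

theorem GoodSample.tvDist_laplace_le (h : B.GoodSample y m θs n r ρ L η₁ η₂ E 4 2) (hn : 1 ≤ n)
    (hd : 1 ≤ d) (hM : 1 ≤ M) (hr : r = M * Real.sqrt d / Real.sqrt n) (hL : 0 < L)
    (hη₁ : 0 < η₁) (hη₂ : 0 < η₂) (hK : 1 ≤ K) (hKL : 2 * L ≤ K) (hρ : 0 < ρ) (hκ0 : 0 < κ)
    (hκ : 64 * κ ≤ (min (ρ / 2) (1 / (4 * K))) ^ 2) (hθs : θs ∈ B.Θ) (hπ₀ : 0 < π₀)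
    (hprior : π₀ ≤ B.prior θs) (hE : 0 ≤ E)
    (htail : E ≤ π₀ * (((n : ℝ) ^ 2)⁻¹ * (2 * Real.pi / (n * η₂)) ^ ((d : ℝ) / 2)))
    (htail' : 1 * Real.exp (-(η₁ * M ^ 2 * d / 2)) * Real.sqrt 2 ^ d ≤ ((n : ℝ) ^ 2)⁻¹) :
    tvDist (B.post y) (B.skewPerturb y m (B.laplace y m))
      ≤ ENNReal.ofReal ((2 / κ + 1536 * K ^ 2 + 8) * (M ^ 6 * d ^ 3 / n)) := by
  have hn1 : (1 : ℝ) ≤ n := by exact_mod_cast hn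
  have hd1 : (1 : ℝ) ≤ d := by exact_mod_cast hd
  have hr0 : 0 ≤ r := by rw [hr]; positivity
  have hrate0 : 0 ≤ M ^ 6 * d ^ 3 / n := by positivity
  rcases le_or_gt (M ^ 6 * d ^ 3 / n) κ with hle | hgt
  · obtain ⟨s1, s2⟩ := scale_le hn hr hρ hK hκ hle
    have hnR : 1 ≤ n * (2 * r) ^ 2 := by
      rw [sq_radius hn hr]; nlinarith [one_le_pow₀ hM (n := 2)]
    have hRt := (scale_bounds hn (by positivity : 0 ≤ 2 * r) hnR).1
    have hreg := h.regular (by linarith)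
    -- Positivity at `θs` is not assumed: `θs` lies in the regularity ball of the mode.
    have hlik : 0 < B.lik θs y := (hreg θs (by
      rw [Metric.mem_ball, dist_comm, dist_eq_norm]; linarith [h.near])).2.1.1
    have key := h.isMAP.tvDist_le (f := B.laplace y m) (P := fun _ => 1) (C := 1)
      (ε := 6 * (K * (n * (2 * r) ^ 3)) ^ 2) (τ := ((n : ℝ) ^ 2)⁻¹) hn hθs hlik hπ₀ hprior h.near
      (by positivity) le_rfl (h.separated hlik) hE hη₁ hη₂ h.le_quadForm h.quadForm_le
      continuous_const (fun _ => by norm_num) zero_le_one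
      (fun v => by rw [one_mul]; exact Real.one_le_exp (by positivity)) (by positivity)
      (fun v hv => by
        simpa only [mul_one] using h.isMAP.local_expansion_two hρ hreg hn hL (by positivity)
          (by linarith) hnR hK hKL s2 hv)
      (fun θ => by simpa only [mul_one] using laplace_eq h.posDef θ) (by positivity) htail
      (by
        rwa [show n * η₁ * (2 * r) ^ 2 / 8 = η₁ * M ^ 2 * d / 2 by
          rw [mul_right_comm, sq_radius hn hr]; ring])
    refine key.trans (ENNReal.ofReal_le_ofReal ?_)
    have hinv : ((n : ℝ) ^ 2)⁻¹ ≤ M ^ 6 * d ^ 3 / n := by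
      refine le_trans ?_ (inv_le_rate hn hd hM)
      gcongr
      exact le_self_pow₀ hn1 (by norm_num)
    -- The constants are `1536 = 4 · 6 · 64` from the local error and `8 = 4 · 2` from the two
    -- tails; `2 / κ` covers the other regime.
    rw [mul_pow, sq_scale hn hr]
    have : 0 ≤ 2 / κ * (M ^ 6 * d ^ 3 / n) := by positivity
    linarith
  · refine (tvDist_laplace_le_two h.posDef).trans ?_
    rw [show (2 : ENNReal) = ENNReal.ofReal 2 by simp]
    refine ENNReal.ofReal_le_ofReal ?_
    have h2 : 2 ≤ 2 / κ * (M ^ 6 * d ^ 3 / n) := by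
      rw [div_mul_eq_mul_div, le_div_iff₀ hκ0]; linarith
    have : 0 ≤ (1536 * K ^ 2 + 8) * (M ^ 6 * d ^ 3 / n) := by positivity
    linarith

theorem GoodSample.tvDist_snp_le (h : B.GoodSample y m θs n r ρ L η₁ η₂ E 6 4) (hn : 1 ≤ n)
    (hd : 1 ≤ d) (hM : 1 ≤ M) (hr : r = M * Real.sqrt d / Real.sqrt n) (hL : 0 < L)
    (hη₁ : 0 < η₁) (hη₂ : 0 < η₂) (hK : 1 ≤ K) (hKL : 2 * L ≤ K) (hρ : 0 < ρ) (hκ0 : 0 < κ)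
    (hκ : 64 * κ ≤ (min (ρ / 2) (1 / (4 * K))) ^ 2) (hθs : θs ∈ B.Θ) (hπ₀ : 0 < π₀)
    (hprior : π₀ ≤ B.prior θs) (hE : 0 ≤ E)
    (htail : E ≤ π₀ * (((n : ℝ) ^ 2)⁻¹ * (2 * Real.pi / (n * η₂)) ^ ((d : ℝ) / 2)))
    (htail' : (1 + L * (2 * (8 / η₁) ^ 2) + L ^ 2 * (24 * (8 / η₁) ^ 4)
      + L ^ 2 * (6 * (8 / η₁) ^ 3)) * Real.exp (-(η₁ * M ^ 2 * d / 2)) * Real.sqrt 2 ^ d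
        ≤ ((n : ℝ) ^ 2)⁻¹) :
    tvDist (B.post y) (B.skewPerturb y m (B.snp y m))
      ≤ ENNReal.ofReal ((2 / κ ^ 2 + 1638400 * K ^ 4 + 8) * (M ^ 6 * d ^ 3 / n) ^ 2) := by
  have hn1 : (1 : ℝ) ≤ n := by exact_mod_cast hn
  have hd1 : (1 : ℝ) ≤ d := by exact_mod_cast hd
  have hr0 : 0 ≤ r := by rw [hr]; positivity
  have hrate0 : 0 ≤ M ^ 6 * d ^ 3 / n := by positivity
  rcases le_or_gt (M ^ 6 * d ^ 3 / n) κ with hle | hgt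
  · obtain ⟨s1, s2⟩ := scale_le hn hr hρ hK hκ hle
    have hnR : 1 ≤ n * (2 * r) ^ 2 := by
      rw [sq_radius hn hr]; nlinarith [one_le_pow₀ hM (n := 2)]
    have hRt := (scale_bounds hn (by positivity : 0 ≤ 2 * r) hnR).1
    have hreg := h.regular (by linarith)
    have hlik : 0 < B.lik θs y := (hreg θs (by
      rw [Metric.mem_ball, dist_comm, dist_eq_norm]; linarith [h.near])).2.1.1
    have hgpos : 0 < ∫ v, Real.exp (-(1 / 2) * quadForm (B.negHess y m) v) := by
      have hn0 : (0 : ℝ) < n := by linarith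
      refine lt_of_lt_of_le ?_ (le_integral_exp_neg_quadForm (mul_pos hn0 hη₁) (mul_pos hn0 hη₂)
        h.le_quadForm h.quadForm_le)
      have := Real.pi_pos
      positivity
    have key := h.isMAP.tvDist_le (f := B.snp y m) (P := B.snpPoly y m)
      (ε := 100 * (K * (n * (2 * r) ^ 3)) ^ 4) (τ := ((n : ℝ) ^ 2)⁻¹) hn hθs hlik hπ₀ hprior h.near
      (by positivity) le_rfl (h.separated hlik) hE hη₁ hη₂ h.le_quadForm h.quadForm_le
      continuous_snpPoly half_le_snpPoly (by positivity)
      (snpPoly_le_exp hn hL hη₁ (hreg.abs_likTensor_le hρ le_rfl (by norm_num))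
        (hreg.abs_likTensor_le hρ (by norm_num) (by norm_num))) (by positivity)
      (fun v hv => h.isMAP.local_expansion_four hρ hreg hn hL (by positivity)
          (by linarith) hnR hK hKL s2 hv)
      (snp_eq h.posDef hgpos) (by positivity) htail
      (by
        rwa [show n * η₁ * (2 * r) ^ 2 / 8 = η₁ * M ^ 2 * d / 2 by
          rw [mul_right_comm, sq_radius hn hr]; ring])
    refine key.trans (ENNReal.ofReal_le_ofReal ?_)
    have hinv : ((n : ℝ) ^ 2)⁻¹ ≤ (M ^ 6 * d ^ 3 / n) ^ 2 := by
      rw [← inv_pow]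
      have := inv_le_rate hn hd hM
      gcongr
    -- Here `1638400 = 4 · 100 · 64²`.
    have h4 : (K * (n * (2 * r) ^ 3)) ^ 4 = K ^ 4 * (64 * (M ^ 6 * d ^ 3 / n)) ^ 2 := by
      rw [← sq_scale hn hr]; ring
    rw [h4]
    have : 0 ≤ 2 / κ ^ 2 * (M ^ 6 * d ^ 3 / n) ^ 2 := by positivity
    linarith
  · refine (tvDist_snp_le_two y m).trans ?_
    rw [show (2 : ENNReal) = ENNReal.ofReal 2 by simp]
    refine ENNReal.ofReal_le_ofReal ?_
    have h2 : 2 ≤ 2 / κ ^ 2 * (M ^ 6 * d ^ 3 / n) ^ 2 := by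
      rw [div_mul_eq_mul_div, le_div_iff₀ (by positivity)]
      have : κ ^ 2 ≤ (M ^ 6 * d ^ 3 / n) ^ 2 := by gcongr
      linarith
    have : 0 ≤ (1638400 * K ^ 4 + 8) * (M ^ 6 * d ^ 3 / n) ^ 2 := by positivity
    linarith

end

end BayesModel

/-! ### Events of probability tending to one. -/

section Probability

variable {Y : ℕ → Type*} [∀ n, MeasurableSpace (Y n)] {P : ∀ n, Measure (Y n)}

theorem WithProbToOne.inter {E F : ∀ n, Set (Y n)} (hE : WithProbToOne P E)
    (hF : WithProbToOne P F) : WithProbToOne P fun n => E n ∩ F n := by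
  have h := hE.add hF
  rw [add_zero] at h
  refine tendsto_of_tendsto_of_tendsto_of_le_of_le tendsto_const_nhds h (fun _ => zero_le)
    fun n => ?_
  change P n (E n ∩ F n)ᶜ ≤ P n (E n)ᶜ + P n (F n)ᶜ
  rw [compl_inter]
  exact measure_union_le _ _

theorem WithProbToOne.mono {E F : ∀ n, Set (Y n)} (hE : WithProbToOne P E)
    (h : ∀ᶠ n in atTop, E n ⊆ F n) : WithProbToOne P F :=
  tendsto_of_tendsto_of_tendsto_of_le_of_le' tendsto_const_nhds hE
    (Eventually.of_forall fun _ => zero_le)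
    (h.mono fun _ hn => measure_mono (compl_subset_compl.2 hn))

theorem withProbToOne_of_ae {E : ∀ n, Set (Y n)} (h : ∀ n, ∀ᵐ y ∂P n, y ∈ E n) :
    WithProbToOne P E := by
  have : ∀ n, P n (E n)ᶜ = 0 := fun n => ae_iff.1 (h n)
  simp [WithProbToOne, this]

/-- An event of probability tending to one on which a deterministic bound holds yields `O_P`. -/
theorem WithProbToOne.isBigOProb {G : ∀ n, Set (Y n)} (hG : WithProbToOne P G)
    {X : ∀ n, Y n → ENNReal} {r : ℕ → ℝ} {K : ℝ} (hK : 0 < K)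
    (h : ∀ᶠ n in atTop, ∀ y ∈ G n, X n y ≤ ENNReal.ofReal (K * r n)) : IsBigOProb P X r := by
  intro ε hε
  refine ⟨K, hK, ?_⟩
  filter_upwards [h, hG.eventually_le_const (ENNReal.ofReal_pos.2 hε)] with n hn hn'
  refine (measure_mono ?_).trans hn'
  intro y hy hyG
  exact absurd (hn y hyG) (not_le.2 hy)

/-- Markov's inequality for the squared norm: the failure probability is at most `C / M²`, with the
dimension cancelling. -/
theorem withProbToOne_norm_le {d : ℕ → ℕ} (hd : ∀ n, 0 < d n) {X : ∀ n, Y n → Par (d n)}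
    (hX : ∀ n, Measurable (X n)) {M : ℕ → ℝ} (hM : Tendsto M atTop atTop) {C : ℝ}
    (h : ∀ᶠ n : ℕ in atTop,
      ∫⁻ y, ENNReal.ofReal (‖X n y‖ ^ 2) ∂(P n) ≤ ENNReal.ofReal (C * (d n / n))) :
    WithProbToOne P fun n => {y | ‖X n y‖ ≤ M n * Real.sqrt (d n) / Real.sqrt n} := by
  have hlim : Tendsto (fun n => ENNReal.ofReal (C / M n ^ 2)) atTop (𝓝 0) := by
    have h1 : Tendsto (fun n => C / M n ^ 2) atTop (𝓝 0) :=
      ((tendsto_pow_atTop two_ne_zero).comp hM).const_div_atTop C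
    simpa using ENNReal.tendsto_ofReal h1
  refine tendsto_of_tendsto_of_tendsto_of_le_of_le' tendsto_const_nhds hlim
    (Eventually.of_forall fun _ => zero_le) ?_
  filter_upwards [h, hM.eventually_ge_atTop 1, eventually_ge_atTop 1] with n hn hMn hn1
  have hn0 : (0 : ℝ) < n := by exact_mod_cast hn1
  have hd0 : (0 : ℝ) < d n := by exact_mod_cast hd n
  have hM0 : 0 < M n := by linarith
  set s : ℝ := M n ^ 2 * (d n / n) with hs
  have hs0 : 0 < s := by positivity
  have hsub : {y | ‖X n y‖ ≤ M n * Real.sqrt (d n) / Real.sqrt n}ᶜ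
      ⊆ {y | ENNReal.ofReal s ≤ ENNReal.ofReal (‖X n y‖ ^ 2)} := by
    intro y hy
    have hy' : M n * Real.sqrt (d n) / Real.sqrt n < ‖X n y‖ := not_le.1 hy
    refine ENNReal.ofReal_le_ofReal ?_
    have h2 := pow_le_pow_left₀ (by positivity) hy'.le 2
    rw [div_pow, mul_pow, Real.sq_sqrt hd0.le, Real.sq_sqrt hn0.le] at h2
    rw [hs, ← mul_div_assoc]
    exact h2
  have hmeas : AEMeasurable (fun y => ENNReal.ofReal (‖X n y‖ ^ 2)) (P n) :=
    (((hX n).norm.pow_const 2).ennreal_ofReal).aemeasurable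
  calc P n {y | ‖X n y‖ ≤ M n * Real.sqrt (d n) / Real.sqrt n}ᶜ
      ≤ P n {y | ENNReal.ofReal s ≤ ENNReal.ofReal (‖X n y‖ ^ 2)} := measure_mono hsub
    _ ≤ (∫⁻ y, ENNReal.ofReal (‖X n y‖ ^ 2) ∂(P n)) / ENNReal.ofReal s :=
        meas_ge_le_lintegral_div hmeas (ENNReal.ofReal_pos.2 hs0).ne' ENNReal.ofReal_ne_top
    _ ≤ ENNReal.ofReal (C * (d n / n)) / ENNReal.ofReal s := by gcongr
    _ = ENNReal.ofReal (C / M n ^ 2) := by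
        rw [← ENNReal.ofReal_div_of_pos hs0]
        congr 1
        rw [hs]
        field_simp

end Probability

/-! ### From the assumptions to the good event. -/

namespace BayesModel

variable {d : ℕ} {Y : Type*} [MeasurableSpace Y] {B : BayesModel d Y} {y : Y} {m θs : Par d} {n : ℕ}

/-- Points of zero likelihood, where the logarithm is `-∞`, satisfy the bound trivially; elsewhere
the extended-real quotient is real. -/
theorem lik_le_of_iSup_lt {S : Set (Par d)} {c : ℝ} (hn : 1 ≤ n)
    (h : (⨆ θ ∈ S, (B.elogLik y θ - B.elogLik y θs) / ((n : ℝ) : EReal)) < (c : EReal))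
    (hlik : 0 < B.lik θs y) {θ : Par d} (hθ : θ ∈ S) :
    B.lik θ y ≤ B.lik θs y * Real.exp (n * c) := by
  have hn0 : (0 : ℝ) < n := by exact_mod_cast hn
  have hlog : ∀ θ, 0 < B.lik θ y → B.elogLik y θ = (Real.log (B.lik θ y) : EReal) := fun θ hθ =>
    ENNReal.log_ofReal_of_pos hθ
  rcases (B.lik_nonneg θ y).eq_or_lt with h0 | h0
  · rw [← h0]; positivity
  · have h1 := (le_iSup₂ (f := fun θ (_ : θ ∈ S) =>
      (B.elogLik y θ - B.elogLik y θs) / ((n : ℝ) : EReal)) θ hθ).trans_lt h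
    rw [hlog θ h0, hlog θs hlik, ← EReal.coe_sub, ← EReal.coe_div, EReal.coe_lt_coe_iff,
      div_lt_iff₀ hn0] at h1
    rw [← Real.exp_log h0, ← Real.exp_log hlik, ← Real.exp_add]
    refine Real.exp_le_exp.2 ?_
    linarith

theorem hessian_bounds {η₁ η₂ : ℝ} (hn : 1 ≤ n) (hη₁ : 0 < η₁)
    (h : ∃ h : ((n : ℝ)⁻¹ • B.negHess y m).IsHermitian,
      ∀ i, η₁ < h.eigenvalues i ∧ h.eigenvalues i < η₂) :
    (B.negHess y m).PosDef ∧ (∀ v, n * η₁ * ‖v‖ ^ 2 ≤ quadForm (B.negHess y m) v) ∧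
      ∀ v, quadForm (B.negHess y m) v ≤ n * η₂ * ‖v‖ ^ 2 := by
  obtain ⟨hH, hev⟩ := h
  have hn0 : (0 : ℝ) < n := by exact_mod_cast hn
  have hJ : B.negHess y m = (n : ℝ) • ((n : ℝ)⁻¹ • B.negHess y m) := by
    rw [smul_smul, mul_inv_cancel₀ hn0.ne', one_smul]
  have hpd : ((n : ℝ)⁻¹ • B.negHess y m).PosDef :=
    hH.posDef_iff_eigenvalues_pos.2 fun i => hη₁.trans (hev i).1
  refine ⟨?_, fun v => ?_, fun v => ?_⟩
  · rw [hJ]; exact hpd.smul hn0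
  · rw [hJ, quadForm_smul, mul_assoc]
    exact mul_le_mul_of_nonneg_left (_root_.le_quadForm hH (fun i => (hev i).1.le) v) hn0.le
  · rw [hJ, quadForm_smul, mul_assoc]
    exact mul_le_mul_of_nonneg_left (_root_.quadForm_le hH (fun i => (hev i).2.le) v) hn0.le

/-- A mode within `r₀/2` of `θs` has its own `r₀/2`-ball in the interior of `Θ`, where the
derivative bounds apply. -/
theorem locallyRegular_of_ball_subset {j k : ℕ} {δ r₀ L : ℝ} (hn : 1 ≤ n)
    (hball : Metric.ball θs r₀ ⊆ B.Θ) (hm : ‖m - θs‖ < min δ (r₀ / 2))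
    (h : ∀ θ ∈ interior B.Θ, ‖m - θ‖ < δ →
      (0 < B.lik θ y ∧ ContDiffAt ℝ j (B.logLik y) θ ∧
        ∀ i, 3 ≤ i → i ≤ j → ‖iteratedFDeriv ℝ i (B.logLik y) θ‖ / n < L) ∧
      (0 < B.prior θ ∧ ContDiffAt ℝ k B.logPrior θ ∧
        ∀ i, 2 ≤ i → i ≤ k → ‖iteratedFDeriv ℝ i B.logPrior θ‖ < L)) :
    B.LocallyRegular y m (min δ (r₀ / 2)) n L j k := by
  intro θ hθ
  have hn0 : (0 : ℝ) < n := by exact_mod_cast hn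
  rw [Metric.mem_ball, dist_eq_norm] at hθ
  have h1 : θ ∈ Metric.ball θs r₀ := by
    rw [Metric.mem_ball, dist_eq_norm]
    have : ‖θ - θs‖ ≤ ‖θ - m‖ + ‖m - θs‖ := norm_sub_le_norm_sub_add_norm_sub _ _ _
    linarith [min_le_right δ (r₀ / 2)]
  have h2 : θ ∈ interior B.Θ := interior_maximal hball Metric.isOpen_ball h1
  obtain ⟨⟨a1, a2, a3⟩, a4, a5, a6⟩ := h θ h2
    (by rw [norm_sub_rev]; linarith [min_le_left δ (r₀ / 2)])
  refine ⟨hball h1, ⟨a1, a2, fun i hi hij => ?_⟩, a4, a5, fun i hi hik => (a6 i hi hik).le⟩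
  have := a3 i hi hij
  rw [div_lt_iff₀ hn0] at this
  linarith

end BayesModel

section Asymptotics

variable {d : ℕ → ℕ} {Y : ℕ → Type*} [∀ n, MeasurableSpace (Y n)]
  {B : ∀ n, BayesModel (d n) (Y n)} {P₀ : ∀ n, Measure (Y n)}
  {θs : ∀ n, Par (d n)} {map : ∀ n, Y n → Par (d n)}

/-- The separation constant is fixed before the smoothness orders, so one `c₁` serves both
approximations. -/
theorem exists_withProbToOne_goodSample (hd : ∀ n, 0 < d n) {r₀ : ℝ}
    (hball : ∀ n, Metric.ball (θs n) r₀ ⊆ (B n).Θ)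
    (hsep : LikelihoodSeparation B P₀ θs) (hmap : MAPConsistent B P₀ θs map)
    {η₁ η₂ : ℝ} (hη₁ : 0 < η₁)
    (hhess : WithProbToOne P₀ (fun n => {y |
      ∃ h : ((n : ℝ)⁻¹ • (B n).negHess y (map n y)).IsHermitian,
        ∀ i, η₁ < h.eigenvalues i ∧ h.eigenvalues i < η₂})) :
    ∃ c₁ : ℝ, 0 < c₁ ∧ ∀ (δ L : ℝ) (j k : ℕ), DerivativesBounded B P₀ map j k δ L →
      WithProbToOne P₀ fun n => {y | (B n).GoodSample y (map n y) (θs n) n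
        (Real.log n * Real.sqrt (d n) / Real.sqrt n) (min δ (r₀ / 2)) L η₁ η₂
        (Real.exp (-c₁ * Real.log n ^ 2 * d n)) j k} := by
  have hlog : Tendsto (fun n : ℕ => Real.log n) atTop atTop :=
    Real.tendsto_log_atTop.comp tendsto_natCast_atTop_atTop
  obtain ⟨c₁, hc₁, hs⟩ := hsep _ hlog
  obtain ⟨hmeas, hMAP, C, hC⟩ := hmap
  refine ⟨c₁, hc₁, fun δ L j k hder => ?_⟩
  have hnear := withProbToOne_norm_le hd (fun n => (hmeas n).sub_const (θs n)) hlog hC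
  refine ((((withProbToOne_of_ae hMAP).inter hnear).inter hs).inter
    (hhess.inter hder)).mono ?_
  filter_upwards [eventually_ge_atTop 1] with n hn
  rintro y ⟨⟨⟨h1, h2⟩, h3⟩, h4, h5⟩
  obtain ⟨p1, p2, p3⟩ := BayesModel.hessian_bounds hn hη₁ h4
  have hn0 : (n : ℝ) ≠ 0 := by positivity
  refine ⟨h1, h2, fun hlik θ hθ hfar => ?_, p1, p2, p3, fun hr =>
    BayesModel.locallyRegular_of_ball_subset hn (hball n) (lt_of_le_of_lt h2 hr) h5⟩
  have := BayesModel.lik_le_of_iSup_lt hn h3 hlik ⟨hθ, hfar⟩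
  rwa [mul_div_cancel₀ _ hn0] at this

theorem sqrt_log_rpow (n : ℕ) (k : ℕ) :
    Real.sqrt (1 * Real.log n) ^ ((2 * k : ℕ) : ℝ) = Real.log n ^ k := by
  rw [Real.rpow_natCast, pow_mul, one_mul, Real.sq_sqrt (Real.log_natCast_nonneg n)]

end Asymptotics

theorem theorem3 :
    ∃ c₀ c₃ c₄ : ℝ, 0 < c₀ ∧ 0 < c₃ ∧ 0 < c₄ ∧
      ∀ (d : ℕ → ℕ) (_ : ∀ n, 0 < d n)
        (Y : ℕ → Type*) [∀ n, MeasurableSpace (Y n)]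
        (B : ∀ n, BayesModel (d n) (Y n))
        (P₀ : ∀ n, Measure (Y n)) [∀ n, IsProbabilityMeasure (P₀ n)]
        (θs : ∀ n, Par (d n)) (map : ∀ n, Y n → Par (d n)),
        UniqueKLProjection B P₀ θs →
        PriorRegular B θs →
        LikelihoodSeparation B P₀ θs →
        MAPConsistent B P₀ θs map →
        HessianBounded B P₀ map →
        ∀ δ L : ℝ, 0 < δ → 0 < L →
        DerivativesBounded B P₀ map 4 2 δ L →
        IsBigOProb P₀
            (fun n y => tvDist ((B n).post y)
              ((B n).skewPerturb y (map n y) ((B n).laplace y (map n y))))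
            (fun n => Real.sqrt (c₀ * Real.log n) ^ c₃ * (d n : ℝ) ^ 3 / n) ∧
        (DerivativesBounded B P₀ map 6 4 δ L →
          IsBigOProb P₀
            (fun n y => tvDist ((B n).post y)
              ((B n).skewPerturb y (map n y) ((B n).snp y (map n y))))
            (fun n => Real.sqrt (c₀ * Real.log n) ^ c₄ * (d n : ℝ) ^ 6 / (n : ℝ) ^ 2)) := by
  -- With `c₀ = 1`, `M_n² = log n`. The radius uses `log n` itself, so the rates `(log n)⁶` and
  -- `(log n)¹²` become the powers `12` and `24` of `M_n`.
  refine ⟨1, ((2 * 6 : ℕ) : ℝ), ((2 * 12 : ℕ) : ℝ), one_pos, by norm_num, by norm_num, ?_⟩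
  intro d hd Y _ B P₀ _ θs map hKL hprior hsep hmap hhess δ L hδ hL hder
  obtain ⟨⟨r₀, hr₀, hreg⟩, C, hC⟩ := hprior
  obtain ⟨η₁, η₂, hη₁, hη₂, hhess⟩ := hhess
  obtain ⟨c₁, hc₁, hgood⟩ := exists_withProbToOne_goodSample hd (fun n => (hreg n).1) hsep hmap
    hη₁ hhess
  obtain ⟨K, hK, hKL'⟩ : ∃ K : ℝ, 1 ≤ K ∧ 2 * L ≤ K := ⟨max 1 (2 * L), le_max_left _ _, le_max_right _ _⟩
  have hρ : 0 < min δ (r₀ / 2) := by positivity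
  obtain ⟨κ, hκ0, hκ⟩ : ∃ κ : ℝ, 0 < κ ∧
      64 * κ ≤ (min (min δ (r₀ / 2) / 2) (1 / (4 * K))) ^ 2 :=
    ⟨(min (min δ (r₀ / 2) / 2) (1 / (4 * K))) ^ 2 / 64, by positivity, by linarith⟩
  have hlog : Tendsto (fun n : ℕ => Real.log n) atTop atTop :=
    Real.tendsto_log_atTop.comp tendsto_natCast_atTop_atTop
  have htail := eventually_exp_neg_log_sq_le hc₁ hη₂ C
  refine ⟨?_, fun hder' => ?_⟩
  · refine (hgood δ L 4 2 hder).isBigOProb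
      (by positivity : 0 < 2 / κ + 1536 * K ^ 2 + 8) ?_
    filter_upwards [htail, hC, eventually_mul_exp_neg_log_sq_le one_pos hη₁,
      hlog.eventually_ge_atTop 1, eventually_ge_atTop 1] with n t1 t2 t3 hM hn y hy
    rw [sqrt_log_rpow]
    exact hy.tvDist_laplace_le hn (hd n) hM rfl hL hη₁ hη₂ hK hKL' hρ hκ0 hκ (hKL n).1
      (by positivity) t2 (Real.exp_pos _).le (t1 _ (hd n)) (t3 _ (hd n))
  · refine (hgood δ L 6 4 hder').isBigOProb
      (by positivity : 0 < 2 / κ ^ 2 + 1638400 * K ^ 4 + 8) ?_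
    filter_upwards [htail, hC, eventually_mul_exp_neg_log_sq_le
      (by positivity : 0 < 1 + L * (2 * (8 / η₁) ^ 2) + L ^ 2 * (24 * (8 / η₁) ^ 4)
        + L ^ 2 * (6 * (8 / η₁) ^ 3)) hη₁,
      hlog.eventually_ge_atTop 1, eventually_ge_atTop 1] with n t1 t2 t3 hM hn y hy
    rw [sqrt_log_rpow, show Real.log n ^ 12 * (d n : ℝ) ^ 6 / (n : ℝ) ^ 2
      = (Real.log n ^ 6 * (d n : ℝ) ^ 3 / n) ^ 2 by ring]
    exact hy.tvDist_snp_le hn (hd n) hM rfl hL hη₁ hη₂ hK hKL' hρ hκ0 hκ (hKL n).1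
      (by positivity) t2 (Real.exp_pos _).le (t1 _ (hd n)) (t3 _ (hd n))
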